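/- Graphs are finite and may have loops and parallel edges: a graph consists of a finite set of vertices, a finite set of half-edges, a map attaching each half-edge to a vertex, and a fixed-point-free involution pairing the half-edges into edges. The degree of a vertex is the number of half-edges attached to it (so a loop counts twice). $\operatorname{Aut} G$ is the group of pairs (permutation of the vertices, permutation of the half-edges) compatible with this structure; thus it also contains the permutations of parallel edges and the flips of loops. A coloring of $G$ is a map $c\colon V(G)\to\{\text{white},\text{black}\}$, and the black-white polynomial is $$W_G(t)=\sum_{c} t^{a(c)}\in\mathbb Z[t],$$ where $a(c)$ is the number of white vertices $v$ for which the number of edges joining $v$ to black vertices, counted with multiplicity, is even. For the empty graph $W_\emptyset=1$. For a finitely supported vector $\mathbf n=(n_1,n_2,\dots)$ of nonnegative integers let $|\mathbf n|=\sum_k k\,n_k$, let $G(\mathbf n)$ be the set of isomorphism classes of graphs with exactly $n_k$ vertices of degree $k$ for all $k\ge1$ and no vertex of degree $0$, and let $G_c(\mathbf n)\subset G(\mathbf n)$ be the subset of connected graphs (the empty graph is not connected). Let $$\mathscr B(u)=\sum_{\mathbf n}u^{|\mathbf n|}\sum_{G\in G_c(\mathbf n)}\frac{W_G(t)\prod_k\xi_k^{n_k}}{|\operatorname{Aut}G|}\in\mathbb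 Q[t,\xi_1,\xi_2,\dots][[u]].$$ Let $\langle\ \rangle_{bw}$ be the linear functional on polynomials in $b,w,y,z$ with $$\langle b^nw^my^kz^l\rangle_{bw}=W_2(n)\,W_2(m)\,\delta_{kl}\,k!,$$ where $W_2(n)=n!/(2^{n/2}(n/2)!)$ for even $n$ and $W_2(n)=0$ for odd $n$; extend it linearly over $\mathbb Q[t,\xi_1,\xi_2,\dots]$ and coefficientwise to power series in $u$. Let $p(i)=t$ if $i\ge0$ is even and $p(i)=1$ if $i$ is odd, and put $$\mathbf F(n)=(b+y)^n+\sum_{i=0}^n\binom ni p(i)\,w^{n-i}z^i,\qquad S(u)=\sum_{k\ge1}\mathbf F(k)\frac{\xi_ku^k}{k!}.$$ **Theorem.** For every $d\geq 0$ there are only finitely many $\mathbf n$ with $|\mathbf n|=d$, every set $G(\mathbf n)$ is finite, and $$\langle\exp S(u)\rangle_{bw}=\sum_{\mathbf n}u^{|\mathbf n|}\sum_{G\in G(\mathbf n)}\frac{W_G(t)\prod_k\xi_k^{n_k}}{|\operatorname{Aut}G|}.$$ This series has constant term $1$, and $$\mathscr B(u)=\log\,\langle\exp S(u)\rangle_{bw}.$$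 -/

import Mathlib

noncomputable section

namespace BW

/-! ### Multigraphs, with loops and parallel edges, through half-edges -/

/-- A multigraph with vertex set `V` and set of half-edges `H`. Every half-edge `h` is attached to
the vertex `vert h`, and the fixed-point free involution `flip` pairs the half-edges. The edges are
the pairs `{h, flip h}`; such an edge is a loop if `vert (flip h) = vert h`. -/
@[ext] structure Multigraph (V H : Type*) where
  vert : H → V
  flip : H → H
  flip_flip : ∀ h, flip (flip h) = h
  flip_ne : ∀ h, flip h ≠ h

namespace Multigraph

variable {V H V' H' V'' H'' : Type*}

/-- The degree of a vertex: the number of half-edges at it (so that a loop counts twice). -/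
def degree [DecidableEq V] [Fintype H] (G : Multigraph V H) (v : V) : ℕ :=
  (Finset.univ.filter fun h => G.vert h = v).card

/-- The number of half-edges at `v` that belong to an edge whose other end is black
(`1 : ZMod 2` is black, `0 : ZMod 2` is white). For a white vertex `v` this is the sum of the
multiplicities of the edges from `v` to its black neighbours, and loops at `v` do not matter. -/
def blackDegree [DecidableEq V] [Fintype H] (G : Multigraph V H) (c : V → ZMod 2) (v : V) : ℕ :=
  (Finset.univ.filter fun h => G.vert h = v ∧ c (G.vert (G.flip h)) = 1).card

/-- The black-white polynomial `W_G(t)`: the sum over all colorings of `t` to the number of white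
vertices that have an even number of black neighbours, counted with multiplicity. -/
def bwPoly [Fintype V] [DecidableEq V] [Fintype H] (G : Multigraph V H) : Polynomial ℤ :=
  ∑ c : V → ZMod 2,
    Polynomial.X ^ (Finset.univ.filter fun v => c v = 0 ∧ Even (G.blackDegree c v)).card

/-- Two vertices are adjacent if an edge joins them. -/
def Adj (G : Multigraph V H) (a b : V) : Prop :=
  ∃ h, G.vert h = a ∧ G.vert (G.flip h) = b

/-- A multigraph is connected if it has a vertex and any two vertices are joined by a path. -/
def Connected (G : Multigraph V H) : Prop :=
  Nonempty V ∧ ∀ a b : V, Relation.ReflTransGen G.Adj a b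

/-- `G` has profile `n = (n₁, n₂, …)` if it has exactly `n k` vertices of degree `k` for all
`k ≥ 1`, and no others, that is, no vertices of degree `0`. -/
def HasProfile [Fintype V] [DecidableEq V] [Fintype H] (G : Multigraph V H) (n : ℕ+ →₀ ℕ) : Prop :=
  (∀ v, 0 < G.degree v) ∧
    ∀ k : ℕ+, (Finset.univ.filter fun v => G.degree v = (k : ℕ)).card = n k

/-- The automorphism group of `G`: the pairs of a permutation of the vertices and a permutation of
the half-edges that are compatible with the attachment and with the pairing of the half-edges. It
contains the permutations of parallel edges and the flips of loops. -/
def aut (G : Multigraph V H) : Subgroup (Equiv.Perm V × Equiv.Perm H) where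
  carrier := {σ | (∀ h, G.vert (σ.2 h) = σ.1 (G.vert h)) ∧ ∀ h, G.flip (σ.2 h) = σ.2 (G.flip h)}
  one_mem' := by simp
  mul_mem' := by
    rintro σ τ ⟨h1, h2⟩ ⟨h3, h4⟩
    constructor <;> intro h <;> simp [*]
  inv_mem' := by
    rintro σ ⟨h1, h2⟩
    refine ⟨fun h => ?_, fun h => ?_⟩
    · have := h1 (σ.2⁻¹ h)
      rw [← Equiv.Perm.mul_apply, mul_inv_cancel, Equiv.Perm.one_apply] at this
      simp [this]
    · have := h2 (σ.2⁻¹ h)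
      rw [← Equiv.Perm.mul_apply, mul_inv_cancel, Equiv.Perm.one_apply] at this
      simp [this]

/-- An isomorphism of multigraphs. -/
structure Iso (G : Multigraph V H) (G' : Multigraph V' H') where
  vEquiv : V ≃ V'
  hEquiv : H ≃ H'
  vert_comm : ∀ h, G'.vert (hEquiv h) = vEquiv (G.vert h)
  flip_comm : ∀ h, G'.flip (hEquiv h) = hEquiv (G.flip h)

namespace Iso

variable {G : Multigraph V H} {G' : Multigraph V' H'} {G'' : Multigraph V'' H''}

def refl (G : Multigraph V H) : Iso G G := ⟨Equiv.refl _, Equiv.refl _, by simp, by simp⟩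

def symm (e : Iso G G') : Iso G' G :=
  ⟨e.vEquiv.symm, e.hEquiv.symm,
    fun h => by
      have := e.vert_comm (e.hEquiv.symm h)
      simp only [Equiv.apply_symm_apply] at this
      simp [this],
    fun h => by
      have := e.flip_comm (e.hEquiv.symm h)
      simp only [Equiv.apply_symm_apply] at this
      simp [this]⟩

def trans (e : Iso G G') (f : Iso G' G'') : Iso G G'' :=
  ⟨e.vEquiv.trans f.vEquiv, e.hEquiv.trans f.hEquiv,
    fun h => by simp [e.vert_comm, f.vert_comm],
    fun h => by simp [e.flip_comm, f.flip_comm]⟩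

theorem degree_eq [DecidableEq V] [Fintype H] [DecidableEq V'] [Fintype H'] (e : Iso G G') (v : V) :
    G'.degree (e.vEquiv v) = G.degree v := by
  unfold degree
  symm
  apply Finset.card_equiv e.hEquiv
  intro h
  simp [e.vert_comm]

theorem blackDegree_eq [DecidableEq V] [Fintype H] [DecidableEq V'] [Fintype H'] (e : Iso G G')
    (c : V' → ZMod 2) (v : V) :
    G'.blackDegree c (e.vEquiv v) = G.blackDegree (c ∘ e.vEquiv) v := by
  unfold blackDegree
  symm
  apply Finset.card_equiv e.hEquiv
  intro h
  simp [e.vert_comm, e.flip_comm]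

theorem bwPoly_eq [Fintype V] [DecidableEq V] [Fintype H] [Fintype V'] [DecidableEq V']
    [Fintype H'] (e : Iso G G') : G.bwPoly = G'.bwPoly := by
  unfold bwPoly
  symm
  apply Fintype.sum_equiv (e.vEquiv.arrowCongr (Equiv.refl (ZMod 2))).symm
  intro c
  congr 1
  symm
  apply Finset.card_equiv e.vEquiv
  intro v
  simp only [Finset.mem_filter, Finset.mem_univ, true_and, e.blackDegree_eq]
  rfl

theorem hasProfile [Fintype V] [DecidableEq V] [Fintype H] [Fintype V'] [DecidableEq V']
    [Fintype H'] (e : Iso G G') {n : ℕ+ →₀ ℕ} (hG : G.HasProfile n) : G'.HasProfile n := by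
  refine ⟨fun v => ?_, fun k => ?_⟩
  · have := hG.1 (e.symm.vEquiv v)
    rwa [e.symm.degree_eq] at this
  · rw [← hG.2 k]
    apply Finset.card_equiv e.symm.vEquiv
    intro v
    simp [e.symm.degree_eq]

theorem connected (e : Iso G G') (hG : G.Connected) : G'.Connected := by
  refine ⟨hG.1.map e.vEquiv, fun a b => ?_⟩
  have := hG.2 (e.symm.vEquiv a) (e.symm.vEquiv b)
  have h2 := this.lift (p := G'.Adj) e.vEquiv (fun x y hxy => by
    obtain ⟨h, h1, h2⟩ := hxy
    exact ⟨e.hEquiv h, by rw [e.vert_comm, h1], by rw [e.flip_comm, e.vert_comm, h2]⟩)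
  simpa [symm, Function.onFun] using h2

theorem card_aut_eq (e : Iso G G') : Nat.card G.aut = Nat.card G'.aut := by
  refine Nat.card_congr
    ((Equiv.prodCongr e.vEquiv.permCongr e.hEquiv.permCongr).subtypeEquiv ?_)
  rintro ⟨σ, τ⟩
  change ((∀ h, G.vert (τ h) = σ (G.vert h)) ∧ ∀ h, G.flip (τ h) = τ (G.flip h)) ↔
    ((∀ h, G'.vert (e.hEquiv (τ (e.hEquiv.symm h))) = e.vEquiv (σ (e.vEquiv.symm (G'.vert h)))) ∧
      ∀ h, G'.flip (e.hEquiv (τ (e.hEquiv.symm h))) = e.hEquiv (τ (e.hEquiv.symm (G'.flip h))))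
  refine and_congr ?_ ?_
  · rw [← e.hEquiv.forall_congr_right]
    simp [e.vert_comm]
  · rw [← e.hEquiv.forall_congr_right]
    simp [e.flip_comm]

end Iso

end Multigraph

/-! ### Isomorphism classes of finite multigraphs -/

/-- The finite multigraphs whose vertices and half-edges are numbered. -/
abbrev FinMultigraph : Type := Σ s : ℕ × ℕ, Multigraph (Fin s.1) (Fin s.2)

/-- Every finite multigraph is isomorphic to one with numbered vertices and half-edges. -/
theorem exists_iso_finMultigraph {V H : Type*} [Finite V] [Finite H] (G : Multigraph V H) :
    ∃ G' : FinMultigraph, Nonempty (G.Iso G'.2) := by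
  obtain ⟨v, ⟨e⟩⟩ := Finite.exists_equiv_fin V
  obtain ⟨m, ⟨f⟩⟩ := Finite.exists_equiv_fin H
  exact ⟨⟨(v, m),
    ⟨fun h => e (G.vert (f.symm h)), fun h => f (G.flip (f.symm h)),
      fun h => by simp [G.flip_flip],
      fun h hh => G.flip_ne (f.symm h) (f.eq_symm_apply.2 hh)⟩⟩,
    ⟨⟨e, f, fun h => by simp, fun h => by simp⟩⟩⟩

instance isoSetoid : Setoid FinMultigraph where
  r G G' := Nonempty (G.2.Iso G'.2)
  iseqv :=
    ⟨fun G => ⟨Multigraph.Iso.refl G.2⟩, fun ⟨e⟩ => ⟨e.symm⟩, fun ⟨e⟩ ⟨f⟩ => ⟨e.trans f⟩⟩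

/-- The isomorphism classes of finite multigraphs. -/
abbrev GraphClass : Type := Quotient isoSetoid

namespace GraphClass

/-- `W_G(t)`. -/
def bwPoly : GraphClass → Polynomial ℤ :=
  Quotient.lift (fun G => G.2.bwPoly) fun _ _ ⟨e⟩ => e.bwPoly_eq

/-- `|Aut G|`. -/
def cardAut : GraphClass → ℕ :=
  Quotient.lift (fun G => Nat.card G.2.aut) fun _ _ ⟨e⟩ => e.card_aut_eq

def Connected : GraphClass → Prop :=
  Quotient.lift (fun G => G.2.Connected) fun _ _ ⟨e⟩ =>
    propext ⟨e.connected, e.symm.connected⟩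

def HasProfile (n : ℕ+ →₀ ℕ) : GraphClass → Prop :=
  Quotient.lift (fun G => G.2.HasProfile n) fun _ _ ⟨e⟩ =>
    propext ⟨e.hasProfile, e.symm.hasProfile⟩

end GraphClass

/-- `G(n)`: the multigraphs of profile `n`, up to isomorphism. -/
def graphs (n : ℕ+ →₀ ℕ) : Set GraphClass := {G | G.HasProfile n}

/-- `G_c(n)`: the connected multigraphs of profile `n`, up to isomorphism. -/
def connectedGraphs (n : ℕ+ →₀ ℕ) : Set GraphClass := {G | G.HasProfile n ∧ G.Connected}

/-- `|n| = ∑ k n_k`. -/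
def profileSize (n : ℕ+ →₀ ℕ) : ℕ := n.sum fun k m => (k : ℕ) * m

/-! ### The graph series -/

/-- The coefficient ring `ℚ[t, ξ₁, ξ₂, …] = ℚ[t][ξ₁, ξ₂, …]`. -/
abbrev Coeff : Type := MvPolynomial ℕ+ (Polynomial ℚ)

/-- The indeterminate `t`. -/
def t : Coeff := MvPolynomial.C Polynomial.X

/-- The indeterminate `ξ_k`. -/
def ξ (k : ℕ+) : Coeff := MvPolynomial.X k

/-- `W_G(t) ∏ₖ ξ_k ^ n_k / |Aut G|`. -/
def graphTerm (n : ℕ+ →₀ ℕ) (G : GraphClass) : Coeff :=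
  ((G.cardAut : ℚ)⁻¹) • (Polynomial.aeval t G.bwPoly * n.prod fun k m => ξ k ^ m)

/-- `∑ₙ u^|n| ∑_{G ∈ 𝒢(n)} W_G(t) ∏ₖ ξ_k ^ n_k / |Aut G|` for sets `𝒢(n)` of graphs, as a power
series in `u`: its coefficient at `u ^ d` is the sum over all profiles `n` with `|n| = d`. -/
def graphSeries (𝒢 : (ℕ+ →₀ ℕ) → Set GraphClass) : PowerSeries Coeff :=
  PowerSeries.mk fun d => ∑ᶠ n ∈ {n : ℕ+ →₀ ℕ | profileSize n = d}, ∑ᶠ G ∈ 𝒢 n, graphTerm n G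

/-- The generating function `𝓑(u)` of the black-white polynomials of all connected graphs. -/
def connectedSeries : PowerSeries Coeff := graphSeries connectedGraphs

/-! ### The formal measure -/

/-- The pairing variables. -/
inductive PVar
  | b | w | y | z
  deriving DecidableEq

/-- The Wick number `n! / (2^(n/2) (n/2)!)` for even `n`, and `0` for odd `n`. -/
def wick (n : ℕ) : ℚ :=
  if Even n then (n.factorial : ℚ) / (2 ^ (n / 2) * ((n / 2).factorial : ℚ)) else 0

/-- The value `⟨bⁿ wᵐ yᵏ zˡ⟩ = ⟨bⁿ⟩ ⟨wᵐ⟩ ⟨yᵏ zˡ⟩` on a monomial, given by its exponents. -/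
def moment (m : PVar →₀ ℕ) : ℚ :=
  wick (m .b) * wick (m .w) * (if m .y = m .z then ((m .y).factorial : ℚ) else 0)

/-- The linear functional `⟨·⟩_bw` on the polynomials in `b, w, y, z` over a `ℚ`-algebra `R`. -/
def expect (R : Type*) [CommRing R] [Algebra ℚ R] : MvPolynomial PVar R →ₗ[R] R :=
  (MvPolynomial.basisMonomials PVar R).constr R fun m => algebraMap ℚ R (moment m)

theorem expect_monomial (R : Type*) [CommRing R] [Algebra ℚ R] (m : PVar →₀ ℕ) (r : R) :
    expect R (MvPolynomial.monomial m r) = r * algebraMap ℚ R (moment m) := by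
  have h : MvPolynomial.monomial m r = r • MvPolynomial.basisMonomials PVar R m := by
    simp [MvPolynomial.smul_monomial]
  rw [h, map_smul, expect, Module.Basis.constr_basis, smul_eq_mul]

/-- `⟨·⟩_bw` on power series in `u`, coefficient by coefficient. -/
def expectSeries (f : PowerSeries (MvPolynomial PVar Coeff)) : PowerSeries Coeff :=
  PowerSeries.mk fun d => expect Coeff (PowerSeries.coeff d f)

/-! ### The series `S(u)` -/

/-- `p(i)`: `t` if `i` is even, and `1` if `i` is odd. -/
def p (i : ℕ) : Coeff := if Even i then t else 1

open MvPolynomial in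
/-- `F(n) = (b + y)ⁿ + ∑ᵢ (n choose i) p(i) w^(n-i) zⁱ`. -/
def flower (n : ℕ) : MvPolynomial PVar Coeff :=
  (X PVar.b + X PVar.y) ^ n +
    ∑ i ∈ Finset.range (n + 1), (n.choose i : MvPolynomial PVar Coeff) * C (p i) *
      X PVar.w ^ (n - i) * X PVar.z ^ i

/-- `S(u) = ∑_{k ≥ 1} F(k) ξ_k u^k / k!`. -/
def S : PowerSeries (MvPolynomial PVar Coeff) :=
  PowerSeries.mk fun k =>
    if hk : 0 < k then ((k.factorial : ℚ)⁻¹) • (flower k * MvPolynomial.C (ξ ⟨k, hk⟩)) else 0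

theorem constantCoeff_S : PowerSeries.constantCoeff S = 0 := by
  rw [← PowerSeries.coeff_zero_eq_constantCoeff_apply]
  simp [S]

/-- `exp S(u)` is a legitimate substitution. -/
theorem hasSubst_S : PowerSeries.HasSubst S :=
  PowerSeries.HasSubst.of_constantCoeff_zero' constantCoeff_S

/-- `exp S(u)`. -/
def expS : PowerSeries (MvPolynomial PVar Coeff) := (PowerSeries.exp ℚ).subst S

end BW

end

noncomputable section

namespace BW

/-! Everything is counted on multigraphs with numbered vertices and half-edges. By orbit-stabilizer,
an isomorphism class with `v` vertices and `d` half-edges has `v! d! / |Aut G|` such numberings, so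
`coeff_graphSeries` replaces the weights `1 / |Aut G|` by the factor `1 / (v! d!)` on labelled sums.
Isolated vertices are killed by `degVar 0 = 0`, hence only `v ≤ d` matters.

The expectation is evaluated by Wick's formula. The coefficient of `u^d` in `S^v / v!` is a sum over
the attachment maps `f : Fin d → Fin v` (`coeff_mk_factorial_pow`). Expanding the flowers chooses a
color for every vertex and guesses, for every half-edge, the color of the opposite end; the
variables `b, w, y, z` record the pair (own color, guessed color). A contraction swaps the two
entries, so the complete contractions (`card_contraction`) are exactly the pairings into edges for
which all guesses are right. What is left is the sum of `t^a(c)` over all colorings `c`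
(`expect_prod_flower`).

The logarithm is the exponential formula. Splitting off the component of one half-edge gives
`totalWeight_succ`, that is, `T' = B' T` for the series `T` of all graphs and `B` of the connected
ones. With the constant terms `1` and `0` this forces `B = log T`. -/

/-- The indeterminate `ξ_k`, with `ξ_0 = 0`. -/
def degVar (k : ℕ) : Coeff := if hk : 0 < k then ξ ⟨k, hk⟩ else 0

theorem degVar_of_pos {k : ℕ} (hk : 0 < k) : degVar k = ξ ⟨k, hk⟩ := dif_pos hk

theorem degVar_zero : degVar 0 = 0 := dif_neg (lt_irrefl 0)

/-- The contribution of a vertex of color `a` with `i` black neighbours. -/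
def colorWeight (a : ZMod 2) (i : ℕ) : Coeff := if a = 0 ∧ Even i then t else 1

/-! ### Weights of multigraphs -/

namespace Multigraph

variable {V H V' H' : Type*}

instance [Finite V] [Finite H] : Finite (Multigraph V H) :=
  Finite.of_injective (fun G : Multigraph V H => (G.vert, G.flip)) fun G G' h => by
    simp only [Prod.mk.injEq] at h
    exact Multigraph.ext h.1 h.2

instance [Finite V] [Finite H] : Fintype (Multigraph V H) := Fintype.ofFinite _

section Weight

variable [Fintype V] [DecidableEq V] [Fintype H]

/-- The weight `W_G(t) ∏_v ξ_{deg v}`. It vanishes if there are isolated vertices. -/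
def weight (G : Multigraph V H) : Coeff :=
  Polynomial.aeval t G.bwPoly * ∏ v, degVar (G.degree v)

/-- The exponent `a(c)` counts vertices, so its power of `t` splits into one factor per vertex. This
local form is what the disjoint union and the flowers are compared with. -/
theorem aeval_bwPoly (G : Multigraph V H) :
    Polynomial.aeval t G.bwPoly =
      ∑ c : V → ZMod 2, ∏ v, colorWeight (c v) (G.blackDegree c v) := by
  simp only [bwPoly, map_sum, map_pow, Polynomial.aeval_X, colorWeight]
  refine Finset.sum_congr rfl fun c _ => ?_
  rw [Finset.prod_ite]
  simp

theorem Iso.weight_eq [Fintype V'] [DecidableEq V'] [Fintype H'] {G : Multigraph V H}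
    {G' : Multigraph V' H'} (e : Iso G G') : G.weight = G'.weight := by
  rw [weight, weight, e.bwPoly_eq, ← e.vEquiv.prod_comp]
  simp [e.degree_eq]

theorem weight_eq_zero {G : Multigraph V H} (hG : ¬ ∀ v, 0 < G.degree v) : G.weight = 0 := by
  push Not at hG
  obtain ⟨v, hv⟩ := hG
  rw [weight, Finset.prod_eq_zero (Finset.mem_univ v), mul_zero]
  rw [Nat.le_zero.1 hv, degVar_zero]

theorem sum_degree (G : Multigraph V H) : ∑ v, G.degree v = Fintype.card H := by
  simp only [degree, Finset.card_filter]
  rw [Finset.sum_comm]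
  simp

theorem card_le_of_degree_pos {G : Multigraph V H} (hG : ∀ v, 0 < G.degree v) :
    Fintype.card V ≤ Fintype.card H := by
  rw [← G.sum_degree, Fintype.card_eq_sum_ones]
  exact Finset.sum_le_sum fun v _ => hG v

/-- This truncates the sums over the number of vertices, which makes every coefficient in `u`
finite. -/
theorem weight_eq_zero_of_card_lt (G : Multigraph V H) (h : Fintype.card H < Fintype.card V) :
    G.weight = 0 :=
  weight_eq_zero fun hG => absurd (card_le_of_degree_pos hG) (not_le.2 h)

end Weight

/-! ### Orbits of relabellings -/

instance : MulAction (Equiv.Perm V × Equiv.Perm H) (Multigraph V H) where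
  smul σ G := ⟨fun h => σ.1 (G.vert (σ.2⁻¹ h)), fun h => σ.2 (G.flip (σ.2⁻¹ h)),
    fun h => by simp [G.flip_flip],
    fun h hh => G.flip_ne (σ.2⁻¹ h) (σ.2.injective (by simpa using hh))⟩
  one_smul G := rfl
  mul_smul σ τ G := rfl

theorem smul_vert (σ : Equiv.Perm V × Equiv.Perm H) (G : Multigraph V H) (h : H) :
    (σ • G).vert h = σ.1 (G.vert (σ.2⁻¹ h)) := rfl

theorem smul_flip (σ : Equiv.Perm V × Equiv.Perm H) (G : Multigraph V H) (h : H) :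
    (σ • G).flip h = σ.2 (G.flip (σ.2⁻¹ h)) := rfl

theorem smul_eq_iff (σ : Equiv.Perm V × Equiv.Perm H) (G G' : Multigraph V H) :
    σ • G = G' ↔
      (∀ h, G'.vert (σ.2 h) = σ.1 (G.vert h)) ∧ ∀ h, G'.flip (σ.2 h) = σ.2 (G.flip h) := by
  constructor
  · rintro rfl
    simp [smul_vert, smul_flip]
  · rintro ⟨h1, h2⟩
    ext h
    · rw [smul_vert, ← h1]; simp
    · rw [smul_flip, ← h2]; simp

theorem stabilizer_eq_aut (G : Multigraph V H) :
    MulAction.stabilizer (Equiv.Perm V × Equiv.Perm H) G = G.aut := by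
  ext σ
  rw [MulAction.mem_stabilizer_iff, smul_eq_iff]
  rfl

theorem mem_orbit_iff (G G' : Multigraph V H) :
    G' ∈ MulAction.orbit (Equiv.Perm V × Equiv.Perm H) G ↔ Nonempty (G.Iso G') := by
  constructor
  · rintro ⟨σ, hσ⟩
    have := (smul_eq_iff σ G G').1 hσ
    exact ⟨⟨σ.1, σ.2, this.1, this.2⟩⟩
  · rintro ⟨e⟩
    exact ⟨(e.vEquiv, e.hEquiv), (smul_eq_iff _ G G').2 ⟨e.vert_comm, e.flip_comm⟩⟩

/-- Orbit-stabilizer for the relabelling action: orbits are isomorphism classes and stabilizers are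
automorphism groups. -/
theorem card_iso_mul_card_aut [Fintype V] [Fintype H] (G : Multigraph V H) :
    Nat.card {G' : Multigraph V H // Nonempty (G.Iso G')} * Nat.card G.aut =
      (Fintype.card V).factorial * (Fintype.card H).factorial := by
  classical
  have h := MulAction.card_orbit_mul_card_stabilizer_eq_card_group
    (Equiv.Perm V × Equiv.Perm H) (G)
  rw [← Nat.card_eq_fintype_card, ← Nat.card_eq_fintype_card, stabilizer_eq_aut,
    Fintype.card_prod, Fintype.card_perm, Fintype.card_perm] at h
  rw [← h]
  congr 1
  refine Nat.card_congr (Equiv.subtypeEquivRight fun G' => (mem_orbit_iff G G').symm)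

end Multigraph

/-! ### From isomorphism classes to labelled multigraphs -/

namespace GraphClass

/-- The weight `W_G(t) ∏_v ξ_{deg v}` of an isomorphism class. -/
def weight : GraphClass → Coeff :=
  Quotient.lift (fun G => G.2.weight) fun _ _ ⟨e⟩ => e.weight_eq

end GraphClass

/-- The isomorphism class of a multigraph with numbered vertices and half-edges. -/
abbrev Multigraph.toClass {v d : ℕ} (G : Multigraph (Fin v) (Fin d)) : GraphClass :=
  Quotient.mk _ ⟨(v, d), G⟩

/-- The isomorphism classes of multigraphs with `d` half-edges and at most `d` vertices. -/
def classesOfSize (d : ℕ) : Finset GraphClass := by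
  classical
  exact (Finset.range (d + 1)).biUnion fun v =>
    Finset.univ.image fun G : Multigraph (Fin v) (Fin d) => G.toClass

theorem mem_classesOfSize {d : ℕ} {q : GraphClass} :
    q ∈ classesOfSize d ↔
      ∃ v ≤ d, ∃ G : Multigraph (Fin v) (Fin d), G.toClass = q := by
  simp [classesOfSize]

/-- All labelled members of a class have the same weight, and there are `v! d! / |Aut G₀|` of them.
-/
theorem sum_fiber_weight (v d : ℕ) (G₀ : Multigraph (Fin v) (Fin d)) [DecidableEq GraphClass] :
    ∑ G : Multigraph (Fin v) (Fin d),
      (if G.toClass = G₀.toClass then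
        ((v.factorial * d.factorial : ℚ)⁻¹) • G.weight else 0) =
      ((Nat.card G₀.aut : ℚ)⁻¹) • G₀.weight := by
  classical
  have key : ∀ G : Multigraph (Fin v) (Fin d),
      G.toClass = G₀.toClass ↔ Nonempty (G₀.Iso G) := fun G =>
    Quotient.eq.trans ⟨fun ⟨e⟩ => ⟨e.symm⟩, fun ⟨e⟩ => ⟨e.symm⟩⟩
  have h1 : ∀ G : Multigraph (Fin v) (Fin d),
      (if G.toClass = G₀.toClass then
        ((v.factorial * d.factorial : ℚ)⁻¹) • G.weight else 0) =
      if Nonempty (G₀.Iso G) then ((v.factorial * d.factorial : ℚ)⁻¹) • G₀.weight else 0 := by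
    intro G
    by_cases h : Nonempty (G₀.Iso G)
    · rw [if_pos h, if_pos ((key G).2 h), h.some.weight_eq]
    · rw [if_neg h, if_neg fun h' => h ((key G).1 h')]
  rw [Finset.sum_congr rfl fun G _ => h1 G, ← Finset.sum_filter, Finset.sum_const,
    ← Fintype.card_subtype, ← Nat.card_eq_fintype_card, ← Nat.cast_smul_eq_nsmul ℚ, smul_smul]
  have h2 := G₀.card_iso_mul_card_aut
  rw [Fintype.card_fin, Fintype.card_fin] at h2
  have h3 : (Nat.card G₀.aut : ℚ) ≠ 0 := Nat.cast_ne_zero.2 Nat.card_pos.ne'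
  congr 1
  rw [← Nat.cast_mul, ← h2]
  push_cast
  have h4 : (Nat.card {G' : Multigraph (Fin v) (Fin d) // Nonempty (G₀.Iso G')} : ℚ) ≠ 0 := by
    intro h0
    have : (v.factorial * d.factorial : ℚ) = 0 := by
      rw [← Nat.cast_mul, ← h2, Nat.cast_mul, h0, zero_mul]
    exact absurd this (by positivity)
  field_simp

/-- The sum of the weights of all multigraphs with numbered vertices and half-edges that satisfy
an isomorphism invariant predicate. -/
theorem sum_labelled_eq_sum_classes (P : GraphClass → Prop) [DecidablePred P] (d : ℕ) :
    ∑ v ∈ Finset.range (d + 1), ((v.factorial * d.factorial : ℚ)⁻¹) •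
      ∑ G : Multigraph (Fin v) (Fin d), (if P G.toClass then G.weight else 0) =
    ∑ q ∈ classesOfSize d, if P q then ((q.cardAut : ℚ)⁻¹) • q.weight else 0 := by
  classical
  have h1 : ∀ v ∈ Finset.range (d + 1), ((v.factorial * d.factorial : ℚ)⁻¹) •
      ∑ G : Multigraph (Fin v) (Fin d), (if P G.toClass then G.weight else 0) =
      ∑ q ∈ classesOfSize d, if P q then ∑ G : Multigraph (Fin v) (Fin d),
        (if G.toClass = q then
          ((v.factorial * d.factorial : ℚ)⁻¹) • G.weight else 0) else 0 := by
    intro v hv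
    rw [Finset.smul_sum, ← Finset.sum_filter, Finset.sum_comm]
    refine Finset.sum_congr rfl fun G _ => ?_
    rw [Finset.sum_ite_eq]
    simp only [Finset.mem_filter]
    have : G.toClass ∈ classesOfSize d :=
      mem_classesOfSize.2 ⟨v, Nat.lt_succ_iff.1 (Finset.mem_range.1 hv), G, rfl⟩
    by_cases h : P G.toClass <;> simp [h, this]
  rw [Finset.sum_congr rfl h1, Finset.sum_comm]
  refine Finset.sum_congr rfl fun q hq => ?_
  obtain ⟨v, hv, G₀, rfl⟩ := mem_classesOfSize.1 hq
  by_cases h : P G₀.toClass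
  · simp only [h, if_true]
    -- A class determines its number of vertices, so only one value of the outer index contributes.
    rw [Finset.sum_eq_single_of_mem v (Finset.mem_range.2 (Nat.lt_succ_iff.2 hv)), sum_fiber_weight]
    · rfl
    · intro v' _ hv'
      refine Finset.sum_eq_zero fun G _ => if_neg fun hG => hv' ?_
      obtain ⟨e⟩ := Quotient.eq.1 hG
      simpa using Fintype.card_congr e.vEquiv
  · simp [h]

/-! ### Profiles -/

theorem finite_profileSize_eq (d : ℕ) : {n : ℕ+ →₀ ℕ | profileSize n = d}.Finite := by
  classical
  -- From `k * n k ≤ d` follow `k ≤ d` and `n k ≤ d` whenever `n k ≠ 0`, so all these profiles lie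
  -- below one finitely supported function. The cutoff `d + 1` is a positive integer even for `d =
  -- 0`.
  refine (Set.finite_Iic (Finsupp.onFinset (Finset.Icc 1 (Nat.succPNat d))
    (fun k => if k ≤ Nat.succPNat d then d else 0) fun k hk => ?_)).subset fun n hn k => ?_
  · simp only [ne_eq, ite_eq_right_iff, Classical.not_imp] at hk
    exact Finset.mem_Icc.2 ⟨one_le, hk.1⟩
  · rw [Finsupp.onFinset_apply]
    by_cases hk : n k = 0
    · rw [hk]; exact Nat.zero_le _
    have h1 : (k : ℕ) * n k ≤ d := by
      rw [← (show profileSize n = d from hn), profileSize, Finsupp.sum]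
      exact Finset.single_le_sum (f := fun k : ℕ+ => (k : ℕ) * n k) (fun _ _ => Nat.zero_le _)
        (Finsupp.mem_support_iff.2 hk)
    have h2 : k ≤ Nat.succPNat d := by
      rw [← PNat.coe_le_coe, Nat.succPNat_coe]
      exact (Nat.le_mul_of_pos_right _ (Nat.pos_of_ne_zero hk)).trans (h1.trans d.le_succ)
    rw [if_pos h2]
    exact (Nat.le_mul_of_pos_left _ k.pos).trans h1

namespace Multigraph

variable {V H : Type*} [Fintype V] [DecidableEq V] [Fintype H]

/-- The profile of a multigraph without isolated vertices. -/
def profile (G : Multigraph V H) : ℕ+ →₀ ℕ :=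
  ∑ v, if h : 0 < G.degree v then Finsupp.single ((G.degree v).toPNat h) 1 else 0

theorem profile_apply (G : Multigraph V H) (k : ℕ+) :
    G.profile k = (Finset.univ.filter fun v => G.degree v = (k : ℕ)).card := by
  rw [profile, Finsupp.finsetSum_apply, Finset.card_filter]
  refine Finset.sum_congr rfl fun v _ => ?_
  by_cases h : 0 < G.degree v
  · rw [dif_pos h, Finsupp.single_apply]
    exact if_congr PNat.coe_inj.symm rfl rfl
  · have h' : G.degree v ≠ k := fun h' => h (h' ▸ k.pos)
    rw [dif_neg h, if_neg h']
    rfl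

theorem hasProfile_iff (G : Multigraph V H) (n : ℕ+ →₀ ℕ) :
    G.HasProfile n ↔ (∀ v, 0 < G.degree v) ∧ n = G.profile := by
  simp only [HasProfile, Finsupp.ext_iff, profile_apply, eq_comm]

theorem profileSize_profile {G : Multigraph V H} (hG : ∀ v, 0 < G.degree v) :
    profileSize G.profile = Fintype.card H := by
  rw [← G.sum_degree, profileSize, profile]
  rw [← Finsupp.sum_finsetSum_index (by simp) (by intros; ring)]
  refine Finset.sum_congr rfl fun v _ => ?_
  rw [dif_pos (hG v), Finsupp.sum_single_index (by simp), mul_one]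
  rfl

theorem prod_profile {G : Multigraph V H} (hG : ∀ v, 0 < G.degree v) :
    (G.profile.prod fun k m => ξ k ^ m) = ∏ v, degVar (G.degree v) := by
  rw [profile]
  rw [← Finsupp.prod_finsetSum_index (by simp) (by intros; ring)]
  refine Finset.prod_congr rfl fun v _ => ?_
  rw [dif_pos (hG v), Finsupp.prod_single_index (by simp), degVar_of_pos (hG v), pow_one]
  rfl

end Multigraph

/-- The profile fixes the number of half-edges, and without isolated vertices there are at most as
many vertices. -/
theorem graphs_subset_classesOfSize (n : ℕ+ →₀ ℕ) :
    graphs n ⊆ classesOfSize (profileSize n) := by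
  intro q hq
  induction q using Quotient.inductionOn with | _ G
  obtain ⟨⟨v, d⟩, G⟩ := G
  obtain ⟨h1, rfl⟩ := (G.hasProfile_iff n).1 hq
  have h2 := Multigraph.profileSize_profile h1
  have h3 := Multigraph.card_le_of_degree_pos h1
  simp only [Fintype.card_fin] at h2 h3
  rw [Finset.mem_coe, mem_classesOfSize, h2]
  exact ⟨v, h3, G, rfl⟩

theorem finite_graphs (n : ℕ+ →₀ ℕ) : (graphs n).Finite :=
  (Finset.finite_toSet _).subset (graphs_subset_classesOfSize n)

/-- The coefficients of a graph series as sums over multigraphs with numbered vertices and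
half-edges. -/
theorem coeff_graphSeries (P : GraphClass → Prop) [DecidablePred P] (d : ℕ) :
    PowerSeries.coeff d (graphSeries fun n => {q | q.HasProfile n ∧ P q}) =
      ∑ v ∈ Finset.range (d + 1), ((v.factorial * d.factorial : ℚ)⁻¹) •
        ∑ G : Multigraph (Fin v) (Fin d), (if P G.toClass then G.weight else 0) := by
  classical
  rw [sum_labelled_eq_sum_classes, graphSeries, PowerSeries.coeff_mk,
    finsum_mem_eq_finite_toFinset_sum _ (finite_profileSize_eq d)]
  have h1 : ∀ n ∈ (finite_profileSize_eq d).toFinset,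
      ∑ᶠ G ∈ {q : GraphClass | q.HasProfile n ∧ P q}, graphTerm n G =
      ∑ q ∈ classesOfSize d, if q.HasProfile n ∧ P q then graphTerm n q else 0 := by
    intro n hn
    have hn' : profileSize n = d := by simpa using hn
    rw [← Finset.sum_filter, ← finsum_mem_coe_finset]
    refine finsum_mem_congr (Set.ext fun q => ?_) fun _ _ => rfl
    refine ⟨fun hq => ?_, fun hq => ?_⟩
    · simp only [Finset.coe_filter, Set.mem_ofPred_eq]
      refine ⟨?_, hq⟩
      rw [← hn']
      exact graphs_subset_classesOfSize n hq.1
    · simpa using (Finset.mem_filter.1 (Finset.mem_coe.1 hq)).2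
  rw [Finset.sum_congr rfl h1, Finset.sum_comm]
  refine Finset.sum_congr rfl fun q hq => ?_
  obtain ⟨v, hv, G, rfl⟩ := mem_classesOfSize.1 hq
  by_cases hP : P G.toClass
  swap
  · simp [hP]
  -- A class has at most one profile, so the sum over `n` collapses to a single term. If there are
  -- isolated vertices, it has none, and the other side vanishes because the weight does.
  have h2 : ∀ n, GraphClass.HasProfile n G.toClass ↔ (∀ v, 0 < G.degree v) ∧ n = G.profile :=
    fun n => G.hasProfile_iff n
  simp only [hP, and_true, if_true, h2]
  by_cases hG : ∀ v, 0 < G.degree v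
  · have h3 : G.profile ∈ (finite_profileSize_eq d).toFinset := by
      simpa using Multigraph.profileSize_profile hG
    simp only [hG, implies_true, true_and]
    rw [Finset.sum_ite_eq', if_pos h3, graphTerm, Multigraph.prod_profile hG]
    rfl
  · simp only [hG, false_and, if_false, Finset.sum_const_zero]
    have : GraphClass.weight G.toClass = 0 := Multigraph.weight_eq_zero hG
    rw [this, smul_zero]

/-! ### Renaming and disjoint unions -/

namespace Multigraph

variable {V H V' H' V₁ H₁ V₂ H₂ : Type*}

/-- Renaming the vertices and half-edges. -/
def relabel (e : V ≃ V') (f : H ≃ H') : Multigraph V H ≃ Multigraph V' H' where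
  toFun G := ⟨fun h => e (G.vert (f.symm h)), fun h => f (G.flip (f.symm h)),
    fun h => by simp [G.flip_flip],
    fun h hh => G.flip_ne (f.symm h) (f.injective (by simpa using hh))⟩
  invFun G := ⟨fun h => e.symm (G.vert (f h)), fun h => f.symm (G.flip (f h)),
    fun h => by simp [G.flip_flip],
    fun h hh => G.flip_ne (f h) (f.symm.injective (by simpa using hh))⟩
  left_inv G := by ext <;> simp
  right_inv G := by ext <;> simp

/-- A multigraph is isomorphic to its renamings. -/
def isoRelabel (e : V ≃ V') (f : H ≃ H') (G : Multigraph V H) : G.Iso (relabel e f G) :=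
  ⟨e, f, fun h => by simp [relabel], fun h => by simp [relabel]⟩

/-- The disjoint union of two multigraphs. -/
def disjointUnion (G₁ : Multigraph V₁ H₁) (G₂ : Multigraph V₂ H₂) :
    Multigraph (V₁ ⊕ V₂) (H₁ ⊕ H₂) where
  vert := Sum.map G₁.vert G₂.vert
  flip := Sum.map G₁.flip G₂.flip
  flip_flip h := by rcases h with h | h <;> simp [G₁.flip_flip, G₂.flip_flip]
  flip_ne h := by rcases h with h | h <;> simp [G₁.flip_ne, G₂.flip_ne]

/-- Degrees and black degrees are computed inside each part, and a coloring of the union is a pair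
of colorings. -/
theorem weight_disjointUnion [Fintype V₁] [DecidableEq V₁] [Fintype H₁] [Fintype V₂]
    [DecidableEq V₂] [Fintype H₂] (G₁ : Multigraph V₁ H₁) (G₂ : Multigraph V₂ H₂) :
    (G₁.disjointUnion G₂).weight = G₁.weight * G₂.weight := by
  have d1 : ∀ v, (G₁.disjointUnion G₂).degree (Sum.inl v) = G₁.degree v := fun v => by
    
    simp only [degree, Finset.card_filter, Fintype.sum_sum_type]
    simp [-Finset.sum_boole, disjointUnion]
  have d2 : ∀ v, (G₁.disjointUnion G₂).degree (Sum.inr v) = G₂.degree v := fun v => by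
    
    simp only [degree, Finset.card_filter, Fintype.sum_sum_type]
    simp [-Finset.sum_boole, disjointUnion]
  have b1 : ∀ (c₁ : V₁ → ZMod 2) (c₂ : V₂ → ZMod 2) (v : V₁),
      (G₁.disjointUnion G₂).blackDegree (Sum.elim c₁ c₂) (Sum.inl v) = G₁.blackDegree c₁ v :=
    fun c₁ c₂ v => by 
    simp only [blackDegree, Finset.card_filter, Fintype.sum_sum_type]
    simp [-Finset.sum_boole, disjointUnion]
  have b2 : ∀ (c₁ : V₁ → ZMod 2) (c₂ : V₂ → ZMod 2) (v : V₂),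
      (G₁.disjointUnion G₂).blackDegree (Sum.elim c₁ c₂) (Sum.inr v) = G₂.blackDegree c₂ v :=
    fun c₁ c₂ v => by 
    simp only [blackDegree, Finset.card_filter, Fintype.sum_sum_type]
    simp [-Finset.sum_boole, disjointUnion]
  simp only [weight, aeval_bwPoly, Fintype.prod_sum_type, d1, d2]
  rw [mul_mul_mul_comm]
  congr 1
  rw [Finset.sum_mul_sum, ← Finset.sum_product', Finset.univ_product_univ,
    ← (Equiv.sumArrowEquivProdArrow V₁ V₂ (ZMod 2)).symm.sum_comp]
  refine Finset.sum_congr rfl fun c _ => ?_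
  have hc : (Equiv.sumArrowEquivProdArrow V₁ V₂ (ZMod 2)).symm c = Sum.elim c.1 c.2 := rfl
  simp only [hc, b1, b2, Sum.elim_inl, Sum.elim_inr]

/-- The total weight of all multigraphs on given sets. -/
def totalWeight (V H : Type*) [Fintype V] [DecidableEq V] [Fintype H] : Coeff :=
  ∑ G : Multigraph V H, G.weight

open Classical in
/-- The total weight of all connected multigraphs on given sets. -/
def connectedWeight (V H : Type*) [Fintype V] [DecidableEq V] [Fintype H] : Coeff :=
  ∑ G : Multigraph V H, if G.Connected then G.weight else 0

section

variable [Fintype V] [DecidableEq V] [Fintype H] [Fintype V'] [DecidableEq V'] [Fintype H']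

theorem totalWeight_congr (e : V ≃ V') (f : H ≃ H') : totalWeight V H = totalWeight V' H' :=
  Fintype.sum_equiv (relabel e f) _ _ fun G => (isoRelabel e f G).weight_eq

theorem connectedWeight_congr (e : V ≃ V') (f : H ≃ H') :
    connectedWeight V H = connectedWeight V' H' := by
  classical
  refine Fintype.sum_equiv (relabel e f) _ _ fun G => ?_
  have i := isoRelabel e f G
  rw [i.weight_eq]
  exact if_congr ⟨i.connected, i.symm.connected⟩ rfl rfl

end

/-! ### The component of a half-edge -/

/-- The vertex `v` lies in the same component as the half-edge `h₀`. -/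
def Reach (G : Multigraph V H) (h₀ : H) (v : V) : Prop :=
  Relation.ReflTransGen G.Adj (G.vert h₀) v

theorem reach_flip {G : Multigraph V H} {h₀ h : H} (hh : G.Reach h₀ (G.vert h)) :
    G.Reach h₀ (G.vert (G.flip h)) :=
  hh.tail ⟨h, rfl, rfl⟩

theorem reach_flip_iff {G : Multigraph V H} {h₀ h : H} :
    G.Reach h₀ (G.vert (G.flip h)) ↔ G.Reach h₀ (G.vert h) :=
  ⟨fun hh => by simpa [G.flip_flip] using reach_flip hh, reach_flip⟩

theorem Adj.symm {G : Multigraph V H} {a b : V} : G.Adj a b → G.Adj b a := by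
  rintro ⟨h, rfl, rfl⟩
  exact ⟨G.flip h, rfl, by rw [G.flip_flip]⟩

/-- The sub-multigraph on a set of vertices and a set of half-edges. -/
def restrict (G : Multigraph V H) (p : V → Prop) (q : H → Prop)
    (hv : ∀ h, q h → p (G.vert h)) (hf : ∀ h, q h → q (G.flip h)) :
    Multigraph {v // p v} {h // q h} where
  vert h := ⟨G.vert h, hv h h.2⟩
  flip h := ⟨G.flip h, hf h h.2⟩
  flip_flip h := Subtype.ext (G.flip_flip h)
  flip_ne h hh := G.flip_ne h (congrArg Subtype.val hh)

section Glue

variable (p : V → Prop) (q : H → Prop) [DecidablePred p] [DecidablePred q]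

/-- The multigraph assembled from multigraphs on complementary sets. -/
def glue (G₁ : Multigraph {v // p v} {h // q h}) (G₂ : Multigraph {v // ¬ p v} {h // ¬ q h}) :
    Multigraph V H :=
  relabel (Equiv.sumCompl p) (Equiv.sumCompl q) (G₁.disjointUnion G₂)

variable {p q} (G₁ : Multigraph {v // p v} {h // q h})
  (G₂ : Multigraph {v // ¬ p v} {h // ¬ q h})

theorem glue_vert_pos (h : {h // q h}) : (glue p q G₁ G₂).vert h = G₁.vert h := by
  simp [glue, relabel, disjointUnion]

theorem glue_vert_neg (h : {h // ¬ q h}) : (glue p q G₁ G₂).vert h = G₂.vert h := by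
  simp [glue, relabel, disjointUnion]

theorem glue_flip_pos (h : {h // q h}) : (glue p q G₁ G₂).flip h = G₁.flip h := by
  simp [glue, relabel, disjointUnion]

theorem glue_flip_neg (h : {h // ¬ q h}) : (glue p q G₁ G₂).flip h = G₂.flip h := by
  simp [glue, relabel, disjointUnion]

theorem glue_injective {G₁' : Multigraph {v // p v} {h // q h}}
    {G₂' : Multigraph {v // ¬ p v} {h // ¬ q h}} (hG : glue p q G₁ G₂ = glue p q G₁' G₂') :
    G₁ = G₁' ∧ G₂ = G₂' := by
  refine ⟨Multigraph.ext (funext fun h => Subtype.ext ?_) (funext fun h => Subtype.ext ?_),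
    Multigraph.ext (funext fun h => Subtype.ext ?_) (funext fun h => Subtype.ext ?_)⟩
  · rw [← glue_vert_pos G₁ G₂, hG, glue_vert_pos]
  · rw [← glue_flip_pos G₁ G₂, hG, glue_flip_pos]
  · rw [← glue_vert_neg G₁ G₂, hG, glue_vert_neg]
  · rw [← glue_flip_neg G₁ G₂, hG, glue_flip_neg]

theorem glue_restrict (G : Multigraph V H) (hv : ∀ h, q h → p (G.vert h))
    (hf : ∀ h, q h → q (G.flip h)) (hv' : ∀ h, ¬ q h → ¬ p (G.vert h))
    (hf' : ∀ h, ¬ q h → ¬ q (G.flip h)) :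
    glue p q (G.restrict p q hv hf) (G.restrict _ _ hv' hf') = G := by
  refine Multigraph.ext (funext fun h => ?_) (funext fun h => ?_)
  · by_cases hq : q h
    · exact glue_vert_pos _ _ ⟨h, hq⟩
    · exact glue_vert_neg _ _ ⟨h, hq⟩
  · by_cases hq : q h
    · exact glue_flip_pos _ _ ⟨h, hq⟩
    · exact glue_flip_neg _ _ ⟨h, hq⟩

/-- No edge joins the two glued parts, and `G₁` is connected: the component of `h₀` is exactly the
first part. Hence a gluing can be undone. -/
theorem reach_glue (hG : G₁.Connected) {h₀ : H} (h0 : q h₀) (v : V) :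
    (glue p q G₁ G₂).Reach h₀ v ↔ p v := by
  constructor
  · intro hr
    induction hr with
    | refl =>
      have := glue_vert_pos G₁ G₂ ⟨h₀, h0⟩
      simp only at this
      rw [this]
      exact (G₁.vert _).2
    | tail _ hab ih =>
      obtain ⟨h, rfl, rfl⟩ := hab
      by_cases hq : q h
      · have h1 := glue_flip_pos G₁ G₂ ⟨h, hq⟩
        have h2 := glue_vert_pos G₁ G₂ (G₁.flip ⟨h, hq⟩)
        simp only at h1
        rw [h1, h2]
        exact (G₁.vert _).2
      · have h1 := glue_vert_neg G₁ G₂ ⟨h, hq⟩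
        simp only at h1
        rw [h1] at ih
        exact absurd ih (G₂.vert _).2
  · intro hv
    have h1 := (hG.2 (G₁.vert ⟨h₀, h0⟩) ⟨v, hv⟩).lift (p := (glue p q G₁ G₂).Adj) Subtype.val
      (by
        rintro a b ⟨h, rfl, rfl⟩
        exact ⟨h, glue_vert_pos _ _ h, by rw [glue_flip_pos, glue_vert_pos]⟩)
    unfold Reach
    have h2 := glue_vert_pos G₁ G₂ ⟨h₀, h0⟩
    simp only at h2
    rw [h2]
    exact h1

theorem vert_glue_iff (h : H) : p ((glue p q G₁ G₂).vert h) ↔ q h := by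
  by_cases hq : q h
  · have := glue_vert_pos G₁ G₂ ⟨h, hq⟩
    simp only at this
    simp only [hq, iff_true, this]
    exact (G₁.vert _).2
  · have := glue_vert_neg G₁ G₂ ⟨h, hq⟩
    simp only at this
    simp only [hq, iff_false, this]
    exact (G₂.vert _).2

end Glue

/-- A path that starts at the vertex of `h₀` never leaves the component, so it survives the
restriction. Two arbitrary vertices are joined through this base point, since adjacency is
symmetric. -/
theorem connected_restrict_reach (G : Multigraph V H) (h₀ : H) (p : V → Prop) (q : H → Prop)
    (hv : ∀ h, q h → p (G.vert h)) (hf : ∀ h, q h → q (G.flip h))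
    (hp : ∀ v, p v ↔ G.Reach h₀ v) (hq : ∀ h, q h ↔ G.Reach h₀ (G.vert h)) :
    (G.restrict p q hv hf).Connected := by
  have h0 : q h₀ := (hq h₀).2 Relation.ReflTransGen.refl
  have key : ∀ v (hr : G.Reach h₀ v), Relation.ReflTransGen (G.restrict p q hv hf).Adj
      ⟨G.vert h₀, hv h₀ h0⟩ ⟨v, (hp v).2 hr⟩ := by
    intro v hr
    induction hr with
    | refl => exact Relation.ReflTransGen.refl
    | tail hr hab ih =>
      obtain ⟨h, rfl, rfl⟩ := hab
      exact ih.tail ⟨⟨h, (hq h).2 hr⟩, rfl, rfl⟩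
  have : Std.Symm (G.restrict p q hv hf).Adj := ⟨fun _ _ h => Adj.symm h⟩
  refine ⟨⟨⟨G.vert h₀, hv h₀ h0⟩⟩, fun a b => ?_⟩
  have ha := key a ((hp a).1 a.2)
  have hb := key b ((hp b).1 b.2)
  exact (symm ha).trans hb

/-- The multigraphs for which `h₀` has a component with prescribed vertices and half-edges. -/
theorem sum_weight_of_component [Fintype V] [DecidableEq V] [Fintype H] [DecidableEq H] (h₀ : H)
    (s : Finset V) (u : Finset H) (hu : h₀ ∈ u)
    [DecidablePred fun G : Multigraph V H =>
      (∀ v, v ∈ s ↔ G.Reach h₀ v) ∧ ∀ h, h ∈ u ↔ G.Reach h₀ (G.vert h)] :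
    ∑ G : Multigraph V H with
        ((∀ v, v ∈ s ↔ G.Reach h₀ v) ∧ ∀ h, h ∈ u ↔ G.Reach h₀ (G.vert h)), G.weight =
      connectedWeight {v // v ∈ s} {h // h ∈ u} * totalWeight {v // v ∉ s} {h // h ∉ u} := by
  classical
  rw [connectedWeight, ← Finset.sum_filter, totalWeight, Finset.sum_mul_sum,
    ← Finset.sum_product']
  symm
  -- Gluing is the bijection: the component is any connected multigraph on `(s, u)`, and the rest is
  -- an arbitrary multigraph on the complements.
  refine Finset.sum_bij (fun x _ => glue (· ∈ s) (· ∈ u) x.1 x.2) ?_ ?_ ?_ ?_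
  · rintro ⟨G₁, G₂⟩ hG
    have hc : G₁.Connected := by simpa using hG
    refine Finset.mem_filter.2 ⟨Finset.mem_univ _, fun v => ?_, fun h => ?_⟩
    · rw [reach_glue G₁ G₂ hc hu]
    · rw [reach_glue G₁ G₂ hc hu]
      exact (vert_glue_iff (p := (· ∈ s)) (q := (· ∈ u)) G₁ G₂ h).symm
  · rintro ⟨G₁, G₂⟩ _ ⟨G₁', G₂'⟩ _ h
    have := glue_injective G₁ G₂ h
    rw [this.1, this.2]
  · intro G hG
    obtain ⟨-, hs, hu'⟩ := Finset.mem_filter.1 hG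
    have hvu : ∀ h, h ∈ u ↔ G.vert h ∈ s := fun h => (hu' h).trans (hs _).symm
    have hfu : ∀ h, G.flip h ∈ u ↔ h ∈ u := fun h => by rw [hu', hu', reach_flip_iff]
    have hvn : ∀ h, h ∉ u → G.vert h ∉ s := fun h hh h' => hh ((hvu h).2 h')
    have hfn : ∀ h, h ∉ u → G.flip h ∉ u := fun h hh h' => hh ((hfu h).1 h')
    refine ⟨(G.restrict (· ∈ s) (· ∈ u) (fun h => (hvu h).1) (fun h => (hfu h).2),
      G.restrict (· ∉ s) (· ∉ u) hvn hfn), ?_,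
      glue_restrict G (fun h => (hvu h).1) (fun h => (hfu h).2) hvn hfn⟩
    simp only [Finset.mem_product, Finset.mem_filter, Finset.mem_univ, true_and, and_true]
    exact connected_restrict_reach G h₀ _ _ _ _ hs hu'
  · rintro ⟨G₁, G₂⟩ _
    rw [← weight_disjointUnion]
    exact (isoRelabel _ _ _).weight_eq

/-- Multigraphs are sorted by the component of `h₀`; each one belongs to exactly one pair `(s, u)`.
-/
theorem totalWeight_eq_sum_components [Fintype V] [DecidableEq V] [Fintype H] [DecidableEq H]
    (h₀ : H) :
    totalWeight V H = ∑ s : Finset V, ∑ u : Finset H with h₀ ∈ u,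
      connectedWeight {v // v ∈ s} {h // h ∈ u} * totalWeight {v // v ∉ s} {h // h ∉ u} := by
  classical
  have h1 : ∀ s : Finset V, ∀ u ∈ Finset.univ.filter fun u : Finset H => h₀ ∈ u,
      connectedWeight {v // v ∈ s} {h // h ∈ u} * totalWeight {v // v ∉ s} {h // h ∉ u} =
      ∑ G : Multigraph V H, if ((∀ v, v ∈ s ↔ G.Reach h₀ v) ∧
        ∀ h, h ∈ u ↔ G.Reach h₀ (G.vert h)) then G.weight else 0 := fun s u hu => by
    rw [← sum_weight_of_component h₀ s u (Finset.mem_filter.1 hu).2, Finset.sum_filter]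
  rw [Finset.sum_congr rfl fun s _ => Finset.sum_congr rfl (h1 s)]
  simp only [Finset.sum_comm (t := (Finset.univ : Finset (Multigraph V H)))]
  refine Finset.sum_congr rfl fun G _ => ?_
  rw [Finset.sum_eq_single_of_mem (Finset.univ.filter fun v => G.Reach h₀ v) (Finset.mem_univ _),
    Finset.sum_eq_single_of_mem (Finset.univ.filter fun h => G.Reach h₀ (G.vert h))]
  · simp
  · simp only [Finset.mem_filter, Finset.mem_univ, true_and]
    exact Relation.ReflTransGen.refl
  · intro u _ hu
    refine if_neg fun h => hu ?_
    ext x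
    simp [h.2]
  · intro s _ hs
    refine Finset.sum_eq_zero fun u _ => if_neg fun h => hs ?_
    ext x
    simp [h.1]

end Multigraph

/-! ### The recursion for the labelled weights -/

namespace Multigraph

theorem totalWeight_eq_zero {v d : ℕ} (h : d < v) : totalWeight (Fin v) (Fin d) = 0 :=
  Finset.sum_eq_zero fun G _ => G.weight_eq_zero_of_card_lt (by simpa using h)

theorem connectedWeight_eq_zero {v d : ℕ} (h : d < v) : connectedWeight (Fin v) (Fin d) = 0 :=
  Finset.sum_eq_zero fun G _ => by
    rw [G.weight_eq_zero_of_card_lt (by simpa using h), ite_self]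

theorem connectedWeight_fin_zero (v : ℕ) : connectedWeight (Fin v) (Fin 0) = 0 := by
  rcases Nat.eq_zero_or_pos v with rfl | hv
  · refine Finset.sum_eq_zero fun G _ => if_neg fun hG => ?_
    exact hG.1.elim fun x => x.elim0
  · exact connectedWeight_eq_zero hv

theorem totalWeight_fin_zero : totalWeight (Fin 0) (Fin 0) = 1 := by
  have : Subsingleton (Multigraph (Fin 0) (Fin 0)) :=
    ⟨fun _ _ => Multigraph.ext (Subsingleton.elim _ _) (Subsingleton.elim _ _)⟩
  have G : Multigraph (Fin 0) (Fin 0) :=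
    ⟨fun h => h.elim0, fun h => h.elim0, fun h => h.elim0, fun h => h.elim0⟩
  rw [totalWeight, Fintype.sum_subsingleton _ G, weight, aeval_bwPoly]
  simp

/-- Removing `0` leaves an arbitrary subset of the other `d` points, whence the shift to `k + 1`. -/
theorem sum_finset_mem_eq_sum_range {M : Type*} [AddCommMonoid M] (d : ℕ) (f : ℕ → M) :
    ∑ u : Finset (Fin (d + 1)) with 0 ∈ u, f u.card =
      ∑ k ∈ Finset.range (d + 1), d.choose k • f (k + 1) := by
  have h1 := Finset.sum_powerset_apply_card (fun k => f (k + 1))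
    (x := Finset.univ.erase (0 : Fin (d + 1)))
  rw [Finset.card_erase_of_mem (Finset.mem_univ _), Finset.card_univ, Fintype.card_fin,
    Nat.add_sub_cancel] at h1
  rw [← h1]
  refine Finset.sum_bij' (fun u _ => u.erase 0) (fun u _ => insert 0 u) ?_ ?_ ?_ ?_ ?_
  · intro u _
    exact Finset.mem_powerset.2 (Finset.erase_subset_erase _ (Finset.subset_univ _))
  · intro u _
    simp
  · intro u hu
    exact Finset.insert_erase (Finset.mem_filter.1 hu).2
  · intro u hu
    refine Finset.erase_insert fun h => ?_
    exact absurd (Finset.mem_powerset.1 hu h) (Finset.notMem_erase _ _)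
  · intro u hu
    rw [Finset.card_erase_add_one (Finset.mem_filter.1 hu).2]

/-- The root half-edge `0` always goes to the connected factor, so only `d` half-edges are
distributed freely, while all `v` vertices are. -/
theorem totalWeight_succ (v d : ℕ) :
    totalWeight (Fin v) (Fin (d + 1)) =
      ∑ i ∈ Finset.range (v + 1), ∑ k ∈ Finset.range (d + 1), (v.choose i * d.choose k) •
        (connectedWeight (Fin i) (Fin (k + 1)) * totalWeight (Fin (v - i)) (Fin (d - k))) := by
  rw [totalWeight_eq_sum_components 0]
  have h1 : ∀ (s : Finset (Fin v)) (u : Finset (Fin (d + 1))),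
      connectedWeight {x // x ∈ s} {h // h ∈ u} * totalWeight {x // x ∉ s} {h // h ∉ u} =
      connectedWeight (Fin s.card) (Fin u.card) *
        totalWeight (Fin (v - s.card)) (Fin (d + 1 - u.card)) := by
    intro s u
    rw [connectedWeight_congr (Fintype.equivFinOfCardEq (Fintype.card_coe s))
        (Fintype.equivFinOfCardEq (Fintype.card_coe u)),
      totalWeight_congr (V' := Fin (v - s.card)) (H' := Fin (d + 1 - u.card))
        (Fintype.equivFinOfCardEq (by simp [Fintype.card_subtype_compl]))
        (Fintype.equivFinOfCardEq (by simp [Fintype.card_subtype_compl]))]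
  simp only [h1]
  have h2 : ∀ s : Finset (Fin v), _ := fun s => sum_finset_mem_eq_sum_range d fun k =>
    connectedWeight (Fin s.card) (Fin k) * totalWeight (Fin (v - s.card)) (Fin (d + 1 - k))
  simp only [h2]
  have h3 := Finset.sum_powerset_apply_card (fun i => ∑ k ∈ Finset.range (d + 1), d.choose k •
    (connectedWeight (Fin i) (Fin (k + 1)) * totalWeight (Fin (v - i)) (Fin (d + 1 - (k + 1)))))
    (x := (Finset.univ : Finset (Fin v)))
  rw [Finset.powerset_univ, Finset.card_univ, Fintype.card_fin] at h3
  rw [h3]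
  simp only [Finset.smul_sum, smul_smul]
  refine Finset.sum_congr rfl fun i _ => Finset.sum_congr rfl fun k _ => ?_
  rw [Nat.add_sub_add_right]

end Multigraph

/-! ### The generating series and the exponential formula -/

open Multigraph

/-- Both sides sum over the same rectangle of pairs, on the left by `i + j`; `f` vanishes at the
pairs outside it. -/
theorem sum_antidiagonal_range {M : Type*} [AddCommMonoid M] (m n : ℕ) (f : ℕ × ℕ → M)
    (hf : ∀ x, m < x.1 ∨ n < x.2 → f x = 0) :
    ∑ v ∈ Finset.range (m + n + 1), ∑ x ∈ Finset.HasAntidiagonal.antidiagonal v, f x =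
      ∑ i ∈ Finset.range (m + 1), ∑ j ∈ Finset.range (n + 1), f (i, j) := by
  rw [← Finset.sum_product', ← Finset.sum_fiberwise_of_maps_to
    (t := Finset.range (m + n + 1)) (g := fun x : ℕ × ℕ => x.1 + x.2)]
  · refine Finset.sum_congr rfl fun v _ => (Finset.sum_subset ?_ ?_).symm
    · intro x hx
      simpa using (Finset.mem_filter.1 hx).2
    · intro x hx hx'
      refine hf x ?_
      by_contra! h
      refine hx' (Finset.mem_filter.2 ⟨?_, Finset.HasAntidiagonal.mem_antidiagonal.1 hx⟩)
      simp only [Finset.mem_product, Finset.mem_range]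
      lia
  · intro x hx
    simp only [Finset.mem_product, Finset.mem_range] at hx ⊢
    lia

/-- The exponential generating function of the total weights. -/
def totalSeries : PowerSeries Coeff := PowerSeries.mk fun d =>
  ∑ v ∈ Finset.range (d + 1), ((v.factorial * d.factorial : ℚ)⁻¹) • totalWeight (Fin v) (Fin d)

theorem graphSeries_graphs : graphSeries graphs = totalSeries := by
  ext1 d
  have h := coeff_graphSeries (fun _ => True) d
  simp only [and_true, if_true] at h
  rw [totalSeries, PowerSeries.coeff_mk]
  exact h

theorem coeff_connectedSeries (d : ℕ) : PowerSeries.coeff d connectedSeries =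
    ∑ v ∈ Finset.range (d + 1), ((v.factorial * d.factorial : ℚ)⁻¹) •
      connectedWeight (Fin v) (Fin d) := by
  classical
  exact coeff_graphSeries GraphClass.Connected d

theorem constantCoeff_totalSeries : PowerSeries.constantCoeff totalSeries = 1 := by
  rw [← PowerSeries.coeff_zero_eq_constantCoeff_apply, totalSeries, PowerSeries.coeff_mk]
  simp [totalWeight_fin_zero]

theorem constantCoeff_connectedSeries : PowerSeries.constantCoeff connectedSeries = 0 := by
  rw [← PowerSeries.coeff_zero_eq_constantCoeff_apply, coeff_connectedSeries]
  simp [connectedWeight_fin_zero]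

/-- This is `totalWeight_succ` for generating functions; differentiation in `u` accounts for the
root half-edge. -/
theorem derivative_totalSeries :
    PowerSeries.derivative Coeff totalSeries =
      PowerSeries.derivative Coeff connectedSeries * totalSeries := by
  ext1 d
  have hd : ∀ n : ℕ, ∀ x : Coeff, x * ((n : Coeff) + 1) = (n + 1 : ℚ) • x := fun n x => by
    rw [Algebra.smul_def, mul_comm]
    simp
  rw [PowerSeries.coeff_derivative, PowerSeries.coeff_mul, hd]
  simp only [PowerSeries.coeff_derivative, hd, coeff_connectedSeries]
  simp only [totalSeries, PowerSeries.coeff_mk]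
  -- The binomial coefficients and `(d + 1) / (v! (d + 1)!)` combine to `1 / (i! (v - i)! k! (d -
  -- k)!)`.
  have h1 : ∀ v ∈ Finset.range (d + 1 + 1), ((d + 1 : ℚ)) •
      ((v.factorial * (d + 1).factorial : ℚ)⁻¹) • totalWeight (Fin v) (Fin (d + 1)) =
      ∑ y ∈ Finset.HasAntidiagonal.antidiagonal d, ∑ x ∈ Finset.HasAntidiagonal.antidiagonal v,
        ((x.1.factorial * x.2.factorial * y.1.factorial * y.2.factorial : ℚ)⁻¹) •
        (connectedWeight (Fin x.1) (Fin (y.1 + 1)) * totalWeight (Fin x.2) (Fin y.2)) := by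
    intro v _
    rw [Finset.sum_comm, Finset.Nat.sum_antidiagonal_eq_sum_range_succ_mk, totalWeight_succ,
      Finset.smul_sum, Finset.smul_sum]
    refine Finset.sum_congr rfl fun i hi => ?_
    rw [Finset.Nat.sum_antidiagonal_eq_sum_range_succ_mk, Finset.smul_sum, Finset.smul_sum]
    refine Finset.sum_congr rfl fun k hk => ?_
    have hi' : i ≤ v := Nat.lt_succ_iff.1 (Finset.mem_range.1 hi)
    have hk' : k ≤ d := Nat.lt_succ_iff.1 (Finset.mem_range.1 hk)
    rw [← Nat.cast_smul_eq_nsmul ℚ, smul_smul, smul_smul]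
    congr 1
    rw [Nat.cast_mul, Nat.cast_choose ℚ hi', Nat.cast_choose ℚ hk', Nat.factorial_succ]
    push_cast
    have := Nat.cast_ne_zero (R := ℚ).2 v.factorial_ne_zero
    have := Nat.cast_ne_zero (R := ℚ).2 d.factorial_ne_zero
    have : (d + 1 : ℚ) ≠ 0 := by positivity
    field_simp
  rw [Finset.smul_sum, Finset.sum_congr rfl h1, Finset.sum_comm]
  refine Finset.sum_congr rfl fun y hy => ?_
  -- The two factors have `y.1 + 1` and `y.2` half-edges, which bound their numbers of vertices;
  -- beyond these bounds the weights are zero.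
  have hy' : d + 1 + 1 = (y.1 + 1) + y.2 + 1 := by
    rw [← Finset.HasAntidiagonal.mem_antidiagonal.1 hy]; ring
  rw [hy', sum_antidiagonal_range, Finset.smul_sum, Finset.sum_mul_sum]
  · refine Finset.sum_congr rfl fun i _ => Finset.sum_congr rfl fun j _ => ?_
    rw [smul_smul, smul_mul_smul_comm]
    congr 1
    rw [Nat.factorial_succ]
    push_cast
    have : (y.1 + 1 : ℚ) ≠ 0 := by positivity
    field_simp
  · rintro x (hx | hx)
    · rw [connectedWeight_eq_zero hx, zero_mul, smul_zero]
    · rw [totalWeight_eq_zero hx, mul_zero, smul_zero]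

/-- The chain rule, with `log' * (1 + X) = 1` evaluated at `f - 1`. -/
theorem mul_derivative_logOf {R : Type*} [CommRing R] [Algebra ℚ R] {f : PowerSeries R}
    (hf : PowerSeries.constantCoeff f = 1) :
    PowerSeries.derivative R (PowerSeries.logOf f) * f = PowerSeries.derivative R f := by
  have hs : PowerSeries.HasSubst (f - 1) :=
    PowerSeries.HasSubst.of_constantCoeff_zero' (by simp [hf])
  have h1 : PowerSeries.derivative R (PowerSeries.log R) * (1 + PowerSeries.X) = 1 := by
    rw [PowerSeries.deriv_log]
    ext n
    rw [mul_add, mul_one, map_add]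
    rcases n with _ | n
    · simp
    · simp [PowerSeries.coeff_succ_mul_X, PowerSeries.coeff_one, pow_succ]
  have h2 := congrArg (PowerSeries.subst (f - 1)) h1
  have h3 : PowerSeries.subst (f - 1) (1 : PowerSeries R) = 1 := by
    rw [← PowerSeries.coe_substAlgHom hs, map_one]
  rw [PowerSeries.subst_mul hs, PowerSeries.subst_add hs, PowerSeries.subst_X hs, h3,
    add_sub_cancel] at h2
  rw [PowerSeries.logOf_eq, PowerSeries.derivative_subst hs, mul_right_comm, h2, one_mul,
    map_sub, PowerSeries.derivative_one, sub_zero]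

/-- As `f` is a unit, both `g` and `log f` have derivative `f' / f`; without torsion, the derivative
and the constant term determine a series. -/
theorem eq_logOf_of_derivative {R : Type*} [CommRing R] [Algebra ℚ R] [IsAddTorsionFree R]
    {f g : PowerSeries R} (hf : PowerSeries.constantCoeff f = 1)
    (hg : PowerSeries.constantCoeff g = 0)
    (h : PowerSeries.derivative R f = PowerSeries.derivative R g * f) :
    g = PowerSeries.logOf f := by
  refine PowerSeries.derivative.ext ?_ ?_
  · have hu : IsUnit f := PowerSeries.isUnit_iff_constantCoeff.2 (by rw [hf]; exact isUnit_one)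
    refine hu.mul_right_cancel ?_
    rw [← h, mul_derivative_logOf hf]
  · rw [hg, PowerSeries.constantCoeff_logOf hf]

theorem connectedSeries_eq_logOf : connectedSeries = PowerSeries.logOf totalSeries :=
  eq_logOf_of_derivative constantCoeff_totalSeries constantCoeff_connectedSeries
    derivative_totalSeries

/-! ### Wick's formula -/

/-- The pairing variable that a pairing variable is contracted with. -/
def PVar.partner : PVar → PVar
  | .b => .b
  | .w => .w
  | .y => .z
  | .z => .y

theorem PVar.partner_partner (a : PVar) : a.partner.partner = a := by cases a <;> rfl

theorem wick_zero : wick 0 = 1 := by simp [wick]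

/-- One point is matched with one of the `n` others. For `n = 0` the truncated `n - 1` is harmless
because of the factor `n`. -/
theorem wick_succ (n : ℕ) : wick (n + 1) = n * wick (n - 1) := by
  rcases n with _ | n
  · simp [wick]
  rw [Nat.add_sub_cancel]
  by_cases h : Even n
  · obtain ⟨k, rfl⟩ := h
    have h1 : Even (k + k + 1 + 1) := ⟨k + 1, by ring⟩
    have h2 : Even (k + k) := ⟨k, rfl⟩
    rw [wick, wick, if_pos h1, if_pos h2, show (k + k + 1 + 1) / 2 = k + 1 by lia,
      show (k + k) / 2 = k by lia, Nat.factorial_succ, Nat.factorial_succ (k + k),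
      Nat.factorial_succ k]
    have : (k + 1 : ℚ) ≠ 0 := by positivity
    push_cast
    field_simp
    ring
  · have h1 : ¬ Even (n + 1 + 1) := by rwa [Nat.even_add_one, Nat.not_even_iff_odd,
      ← Nat.not_even_iff_odd, Nat.even_add_one, not_not]
    rw [wick, wick, if_neg h1, if_neg h, mul_zero]

theorem moment_zero : moment 0 = 1 := by simp [moment, wick_zero]

/-- Gaussian integration by parts: one factor `a` is contracted with each of its possible partners
in turn. If there are none, the coefficient is zero and the truncated subtraction does not matter.
-/
theorem moment_single_add (a : PVar) (m : PVar →₀ ℕ) :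
    moment (Finsupp.single a 1 + m) =
      m a.partner * moment (m - Finsupp.single a.partner 1) := by
  cases a
  · simp only [moment, PVar.partner, Finsupp.single_apply, Finsupp.add_apply, Finsupp.tsub_apply]
    simp [add_comm 1, wick_succ, mul_assoc, mul_left_comm]
  · simp only [moment, PVar.partner, Finsupp.single_apply, Finsupp.add_apply, Finsupp.tsub_apply]
    simp [add_comm 1, wick_succ, mul_assoc, mul_left_comm]
  · simp only [moment, PVar.partner, Finsupp.single_apply, Finsupp.add_apply, Finsupp.tsub_apply]
    rcases h : m .z with _ | k
    · simp
    · by_cases h' : m .y = k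
      · simp [h', add_comm 1, Nat.factorial_succ]; ring
      · have : 1 + m .y ≠ k + 1 := by lia
        simp [h', this]
  · simp only [moment, PVar.partner, Finsupp.single_apply, Finsupp.add_apply, Finsupp.tsub_apply]
    rcases h : m .y with _ | k
    · have h1 : 0 ≠ 1 + m .z := by lia
      simp [h1]
    · by_cases h' : m .z = k
      · simp [h', add_comm 1, Nat.factorial_succ]; ring
      · have h1 : k + 1 ≠ 1 + m .z := by lia
        have h2 : k ≠ m .z := fun h => h' h.symm
        simp [h1, h2]

section Pairing

variable {H : Type*}

/-- The fixed-point free involutions that are compatible with a labelling by pairing variables. -/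
abbrev Contraction (l : H → PVar) : Type _ :=
  {f : H → H // (∀ h, f (f h) = h) ∧ (∀ h, f h ≠ h) ∧ ∀ h, l (f h) = (l h).partner}

/-- Removing a contracted pair. -/
def contractionEquiv [DecidableEq H] (l : H → PVar) {h₀ h₁ : H} (hne : h₁ ≠ h₀)
    (hl : l h₁ = (l h₀).partner) :
    {f : Contraction l // f.1 h₀ = h₁} ≃
      Contraction fun x : {x : H // x ≠ h₀ ∧ x ≠ h₁} => l x where
  toFun f := ⟨fun x => ⟨f.1.1 x, by
      have h1 := f.1.2.1
      have h2 := f.2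
      have h3 := x.2
      constructor
      · exact fun h => h3.2 (by rw [← h1 x, h]; exact h2)
      · exact fun h => h3.1 
          ((h1 x).symm.trans ((congrArg f.1.1 (h.trans h2.symm)).trans (h1 h₀)))⟩,
    fun x => Subtype.ext (f.1.2.1 x), fun x h => f.1.2.2.1 x (congrArg Subtype.val h),
    fun x => f.1.2.2.2 x⟩
  invFun g := ⟨⟨fun x => if hx : x ≠ h₀ ∧ x ≠ h₁ then g.1 ⟨x, hx⟩ else if x = h₀ then h₁ else h₀, by
      refine ⟨fun x => ?_, fun x => ?_, fun x => ?_⟩ <;> beta_reduce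
      · by_cases hx : x ≠ h₀ ∧ x ≠ h₁
        · simp only [hx, dite_true, ne_eq, not_false_eq_true, and_self]
          rw [dif_pos (g.1 ⟨x, hx⟩).2]
          simp [g.2.1]
        · by_cases h0 : x = h₀
          · simp [h0, hne]
          · have h1 : x = h₁ := by tauto
            simp [h1, hne]
      · by_cases hx : x ≠ h₀ ∧ x ≠ h₁
        · rw [dif_pos hx]
          exact fun h => g.2.2.1 ⟨x, hx⟩ (Subtype.ext h)
        · by_cases h0 : x = h₀
          · simp [h0, hne]
          · have h1 : x = h₁ := by tauto
            simp [h1, hne, hne.symm]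
      · by_cases hx : x ≠ h₀ ∧ x ≠ h₁
        · rw [dif_pos hx]
          exact g.2.2.2 ⟨x, hx⟩
        · by_cases h0 : x = h₀
          · simp [h0, hl]
          · have h1 : x = h₁ := by tauto
            simp [h1, hne, hl, PVar.partner_partner]⟩, by simp⟩
  left_inv f := by
    refine Subtype.ext (Subtype.ext (funext fun x => ?_))
    by_cases hx : x ≠ h₀ ∧ x ≠ h₁
    · simp only [dif_pos hx]
    · simp only [dif_neg hx]
      by_cases h0 : x = h₀
      · rw [if_pos h0, h0, f.2]
      · have h1 : x = h₁ := by tauto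
        rw [if_neg h0, h1]
        exact (f.1.2.1 h₀).symm.trans (congrArg f.1.1 f.2)
  right_inv g := by
    refine Subtype.ext (funext fun x => Subtype.ext ?_)
    simp only [dif_pos x.2]

/-- Wick's formula: the moment of a monomial counts its complete contractions. -/
theorem card_contraction [Fintype H] (l : H → PVar) :
    (Nat.card (Contraction l) : ℚ) = moment (∑ h, Finsupp.single (l h) 1) := by
  classical
  induction hn : Fintype.card H using Nat.strong_induction_on generalizing H with | _ n ih
  subst hn
  rcases isEmpty_or_nonempty H with hH | ⟨⟨h₀⟩⟩
  · have : Nat.card (Contraction l) = 1 := by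
      rw [Nat.card_eq_one_iff_unique]
      exact ⟨⟨fun f g => Subtype.ext (Subsingleton.elim _ _)⟩,
        ⟨⟨fun h => h, fun h => isEmptyElim h, fun h => isEmptyElim h, fun h => isEmptyElim h⟩⟩⟩
    rw [this]
    simp [moment_zero]
  have e : Contraction l ≃ Σ h : H, {f : Contraction l // f.1 h₀ = h} :=
    (Equiv.sigmaFiberEquiv fun f : Contraction l => f.1 h₀).symm
  -- The contractions are sorted by the partner of `h₀`. Every admissible partner leaves the same
  -- monomial, and the number of these partners is the exponent in `moment_single_add`.
  have h1 : ∀ h : H, (Nat.card {f : Contraction l // f.1 h₀ = h} : ℚ) =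
      if h ∈ (Finset.univ.erase h₀).filter fun h => l h = (l h₀).partner then
        moment ((∑ x ∈ Finset.univ.erase h₀, Finsupp.single (l x) 1) -
          Finsupp.single (l h₀).partner 1) else 0 := by
    intro h
    split_ifs with hh
    · simp only [Finset.mem_filter, Finset.mem_erase, Finset.mem_univ, and_true] at hh
      rw [Nat.card_congr (contractionEquiv l hh.1 hh.2), ih _ _ _ rfl]
      · congr 1
        rw [← Finset.add_sum_erase _ _ (Finset.mem_erase.2 ⟨hh.1, Finset.mem_univ h⟩), hh.2,
          add_tsub_cancel_left]
        rw [← Finset.sum_subtype (p := fun x => x ≠ h₀ ∧ x ≠ h)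
          ((Finset.univ.erase h₀).erase h) (by simp [and_comm])
          fun x => Finsupp.single (l x) 1]
      · exact Fintype.card_subtype_lt (x := h₀) (by simp)
    · rw [Nat.cast_eq_zero, Nat.card_eq_zero]
      refine Or.inl ⟨fun f => hh ?_⟩
      obtain ⟨f, rfl⟩ := f
      simp only [Finset.mem_filter, Finset.mem_erase, Finset.mem_univ, and_true]
      exact ⟨f.2.2.1 h₀, f.2.2.2 h₀⟩
  rw [Nat.card_congr e, Nat.card_sigma, Nat.cast_sum, Finset.sum_congr rfl fun h _ => h1 h,
    ← Finset.add_sum_erase _ (fun h => Finsupp.single (l h) 1) (Finset.mem_univ h₀),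
    moment_single_add, Finset.sum_ite_mem,
    Finset.univ_inter, Finset.sum_const, nsmul_eq_mul]
  congr 2
  rw [Finsupp.finsetSum_apply, Finset.card_filter]
  exact Finset.sum_congr rfl fun x _ => Finsupp.single_apply.symm

end Pairing

theorem expect_prod_X {R : Type*} [CommRing R] [Algebra ℚ R] {H : Type*} [Fintype H]
    (l : H → PVar) :
    expect R (∏ h, MvPolynomial.X (l h)) = (Nat.card (Contraction l) : R) := by
  have h1 : (∏ h, MvPolynomial.X (l h) : MvPolynomial PVar R) =
      MvPolynomial.monomial (∑ h, Finsupp.single (l h) 1) 1 :=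
    (MvPolynomial.monomial_sum_one ..).symm
  rw [h1, expect_monomial, ← card_contraction, one_mul, map_natCast]

/-! ### Powers and exponentials of generating functions -/

section ExponentialGeneratingFunctions

/-- The multinomial theorem expands `(∑ X_i)^|H|` in two ways. Since `g` need not be multiplicative,
no evaluation of the `X_i` would do; a linear functional prescribed on monomials does. -/
theorem sum_prod_card_fiber {R : Type*} [CommRing R] {H V : Type*} [Fintype H] [Fintype V] [DecidableEq V] [DecidableEq H]
    (g : ℕ → R) :
    ∑ f : H → V, ∏ i, g (Finset.univ.filter fun h => f h = i).card =
      ∑ k ∈ Finset.univ.piAntidiag (Fintype.card H),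
        (Nat.multinomial (Finset.univ : Finset V) k : R) * ∏ i, g (k i) := by
  let φ : MvPolynomial V R →ₗ[R] R :=
    (MvPolynomial.basisMonomials V R).constr R fun m => ∏ i, g (m i)
  have hφ : ∀ m : V →₀ ℕ, φ (MvPolynomial.monomial m 1) = ∏ i, g (m i) := fun m =>
    (MvPolynomial.basisMonomials V R).constr_basis R _ m
  have h1 := congrArg φ (Finset.sum_pow_eq_sum_piAntidiag (Finset.univ : Finset V)
    (fun i => (MvPolynomial.X i : MvPolynomial V R)) (Fintype.card H))
  rw [← Finset.card_univ, ← Finset.prod_const, Fintype.prod_sum, map_sum, map_sum] at h1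
  have h2 : ∀ f : H → V, φ (∏ h, MvPolynomial.X (f h)) =
      ∏ i, g (Finset.univ.filter fun h => f h = i).card := fun f => by
    have : (∏ h, MvPolynomial.X (f h) : MvPolynomial V R) =
        MvPolynomial.monomial (∑ h, Finsupp.single (f h) 1) 1 :=
      (MvPolynomial.monomial_sum_one ..).symm
    rw [this, hφ]
    refine Finset.prod_congr rfl fun i _ => congrArg g ?_
    rw [Finsupp.finsetSum_apply, Finset.card_filter]
    exact Finset.sum_congr rfl fun h _ => Finsupp.single_apply
  have h3 : ∀ k : V → ℕ, φ ((Nat.multinomial Finset.univ k : MvPolynomial V R) *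
      ∏ i, MvPolynomial.X i ^ k i) = (Nat.multinomial Finset.univ k : R) * ∏ i, g (k i) :=
    fun k => by
    rw [← nsmul_eq_mul, map_nsmul, nsmul_eq_mul]
    have : (∏ i, MvPolynomial.X i ^ k i : MvPolynomial V R) =
        MvPolynomial.monomial (Finsupp.equivFunOnFinite.symm k) 1 := by
      rw [MvPolynomial.monomial_eq, map_one, one_mul, Finsupp.prod_fintype _ _ (by simp)]
      rfl
    rw [this, hφ]
    rfl
  rw [Finset.sum_congr rfl fun f _ => (h2 f).symm, h1, Finset.card_univ]
  exact Finset.sum_congr rfl fun k _ => h3 k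

variable {R : Type*} [CommRing R] [Algebra ℚ R]

/-- Powers of an exponential generating function count maps by their fibres. -/
theorem coeff_mk_factorial_pow (g : ℕ → R) (v d : ℕ) :
    PowerSeries.coeff d ((PowerSeries.mk fun k => ((k.factorial : ℚ)⁻¹) • g k) ^ v) =
      ((d.factorial : ℚ)⁻¹) • ∑ f : Fin d → Fin v,
        ∏ i, g (Finset.univ.filter fun h => f h = i).card := by
  rw [sum_prod_card_fiber, Fintype.card_fin, Finset.smul_sum]
  have h1 : (PowerSeries.mk fun k => ((k.factorial : ℚ)⁻¹) • g k) ^ v =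
      ∏ _i : Fin v, (PowerSeries.mk fun k => ((k.factorial : ℚ)⁻¹) • g k) := by simp
  rw [h1, PowerSeries.coeff_prod]
  refine Finset.sum_bij' (fun k _ => ⇑k) (fun k _ => Finsupp.equivFunOnFinite.symm k) ?_ ?_ ?_ ?_ ?_
  · intro k hk
    simpa using (Finset.mem_finsuppAntidiag.1 hk).1
  · intro k hk
    simpa using (Finset.mem_piAntidiag.1 hk).1
  · intro k _
    ext i; rfl
  · intro k _
    rfl
  · intro k hk
    have hk' := (Finset.mem_finsuppAntidiag.1 hk).1
    -- The factorials `1 / k_i!` become the multinomial coefficient divided by `d!`.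
    have h2 := Nat.multinomial_spec (Finset.univ : Finset (Fin v)) k
    rw [hk'] at h2
    simp only [PowerSeries.coeff_mk]
    rw [Finset.prod_smul, ← nsmul_eq_mul, ← Nat.cast_smul_eq_nsmul ℚ, smul_smul, ← h2]
    congr 1
    push_cast
    have h3 : (Nat.multinomial Finset.univ k : ℚ) ≠ 0 := by
      intro h0
      rw [Nat.cast_eq_zero.1 h0, mul_zero] at h2
      exact d.factorial_ne_zero h2.symm
    rw [Finset.prod_inv_distrib, mul_inv, mul_assoc, inv_mul_cancel₀ h3, mul_one]

/-- As `X` divides `f`, the power `f^v` has no terms of degree below `v`. -/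
theorem coeff_exp_subst {f : PowerSeries R} (hf : PowerSeries.constantCoeff f = 0) (d : ℕ) :
    PowerSeries.coeff d ((PowerSeries.exp ℚ).subst f) =
      ∑ v ∈ Finset.range (d + 1), ((v.factorial : ℚ)⁻¹) • PowerSeries.coeff d (f ^ v) := by
  rw [PowerSeries.coeff_subst' (PowerSeries.HasSubst.of_constantCoeff_zero' hf),
    finsum_eq_sum_of_support_subset (s := Finset.range (d + 1))]
  · simp [PowerSeries.coeff_exp]
  · intro v hv
    rw [Finset.coe_range, Set.mem_Iio]
    by_contra h
    refine hv ?_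
    have h1 : PowerSeries.X ^ v ∣ f ^ v := pow_dvd_pow_of_dvd (PowerSeries.X_dvd_iff.2 hf) v
    beta_reduce
    rw [PowerSeries.X_pow_dvd_iff.1 h1 d (by lia), smul_zero]

/-- The instance of `coeff_exp_subst` for polynomial rings. Unifying the ring structures of iterated
polynomial rings in one step is too expensive. -/
theorem coeff_exp_subst_mvPolynomial {σ : Type*} {f : PowerSeries (MvPolynomial σ R)}
    (hf : PowerSeries.constantCoeff f = 0) (d : ℕ) :
    PowerSeries.coeff d ((PowerSeries.exp ℚ).subst f) =
      ∑ v ∈ Finset.range (d + 1), ((v.factorial : ℚ)⁻¹) • PowerSeries.coeff d (f ^ v) :=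
  coeff_exp_subst hf d

end ExponentialGeneratingFunctions

/-! ### Flowers -/

/-- The pairing variable of a half-edge at a vertex of color `a` whose other end has color `e`. -/
def label (a e : ZMod 2) : PVar :=
  if a = 1 then (if e = 1 then .b else .y) else (if e = 1 then .z else .w)

/-- The other half of an edge sees the same two colors in reverse order. This is why `y` pairs with
`z`, and `b` and `w` with themselves. -/
theorem partner_label (a e : ZMod 2) : (label a e).partner = label e a := by
  revert a e; decide

theorem label_inj (a e a' e' : ZMod 2) : label a e = label a' e' ↔ a = a' ∧ e = e' := by
  revert a e a' e'; decide

theorem zmod_two_ne_one_iff (a : ZMod 2) : a ≠ 1 ↔ a = 0 := by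
  revert a; decide

/-- A binomial expansion with an extra weight on the number of ones: functions to `ZMod 2` are
subsets. -/
theorem sum_zmod_two_functions {R H : Type*} [CommRing R] [Fintype H] [DecidableEq H]
    (f : ℕ → R) (x y : R) :
    ∑ ε : H → ZMod 2, f (Finset.univ.filter fun h => ε h = 1).card *
        ∏ h, (if ε h = 1 then x else y) =
      ∑ i ∈ Finset.range (Fintype.card H + 1),
        ((Fintype.card H).choose i : R) * (f i * (x ^ i * y ^ (Fintype.card H - i))) := by
  have h1 := Finset.sum_powerset_apply_card
    (fun i => f i * (x ^ i * y ^ (Fintype.card H - i))) (x := (Finset.univ : Finset H))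
  simp only [Finset.powerset_univ, Finset.card_univ, nsmul_eq_mul] at h1
  rw [← h1]
  refine Finset.sum_bij' (fun ε _ => Finset.univ.filter fun h => ε h = 1)
    (fun s _ h => if h ∈ s then 1 else 0) (by simp) (by simp) ?_ ?_ ?_
  · intro ε _
    funext h
    by_cases hh : ε h = 1
    · simp [hh]
    · simp [(zmod_two_ne_one_iff _).1 hh]
  · intro s _
    ext h
    by_cases hh : h ∈ s <;> simp [hh]
  · intro ε _
    rw [Finset.prod_ite, Finset.prod_const, Finset.prod_const, Finset.filter_not,
      Finset.card_sdiff_of_subset (Finset.filter_subset _ _), Finset.card_univ]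

/-- The power of `b + y` belongs to a black vertex, the other sum to a white one, where `i` counts
the half-edges whose opposite end is guessed black. -/
theorem flower_card (H : Type*) [Fintype H] [DecidableEq H] :
    flower (Fintype.card H) = ∑ a : ZMod 2, ∑ ε : H → ZMod 2,
      MvPolynomial.C (colorWeight a (Finset.univ.filter fun h => ε h = 1).card) *
        ∏ h, MvPolynomial.X (label a (ε h)) := by
  have h2 : ∀ F : ZMod 2 → MvPolynomial PVar Coeff, ∑ a, F a = F 1 + F 0 := fun F => by
    rw [add_comm]; exact Fin.sum_univ_two F
  rw [h2, flower]
  congr 1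
  · have h3 := sum_zmod_two_functions (H := H) (fun _ => 1)
      (MvPolynomial.X PVar.b : MvPolynomial PVar Coeff) (MvPolynomial.X PVar.y)
    rw [add_pow, Finset.sum_congr rfl fun i _ => (by ring : _ =
      ((Fintype.card H).choose i : MvPolynomial PVar Coeff) * (1 * (MvPolynomial.X PVar.b ^ i *
        MvPolynomial.X PVar.y ^ (Fintype.card H - i)))), ← h3]
    refine Finset.sum_congr rfl fun ε _ => ?_
    have : ∀ i, colorWeight 1 i = 1 := fun i => by simp [colorWeight]
    rw [this, map_one]
    congr 1
    refine Finset.prod_congr rfl fun h _ => ?_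
    by_cases hh : ε h = 1 <;> simp [label, hh]
  · have h3 := sum_zmod_two_functions (H := H) (fun i => MvPolynomial.C (colorWeight 0 i))
      (MvPolynomial.X PVar.z : MvPolynomial PVar Coeff) (MvPolynomial.X PVar.w)
    have h4 : ∀ i, p i = colorWeight 0 i := fun i => by simp [p, colorWeight]
    simp only [h4]
    rw [Finset.sum_congr rfl fun i _ => (by ring : _ =
      ((Fintype.card H).choose i : MvPolynomial PVar Coeff) * (MvPolynomial.C (colorWeight 0 i) *
        (MvPolynomial.X PVar.z ^ i * MvPolynomial.X PVar.w ^ (Fintype.card H - i)))), ← h3]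
    refine Finset.sum_congr rfl fun ε _ => ?_
    congr 1
    refine Finset.prod_congr rfl fun h _ => ?_
    by_cases hh : ε h = 1 <;> simp [label, hh]

section

variable {V H : Type*} [Fintype V] [DecidableEq V] [Fintype H] [DecidableEq H]

theorem prod_flower (f : H → V) :
    ∏ i, flower (Finset.univ.filter fun h => f h = i).card =
      ∑ c : V → ZMod 2, ∑ ε : H → ZMod 2,
        MvPolynomial.C (∏ i, colorWeight (c i)
          (Finset.univ.filter fun h => f h = i ∧ ε h = 1).card) *
        ∏ h, MvPolynomial.X (label (c (f h)) (ε h)) := by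
  have h1 : ∀ i, flower (Finset.univ.filter fun h => f h = i).card =
      flower (Fintype.card {h // f h = i}) := fun i => by rw [Fintype.card_subtype]
  simp only [h1, flower_card]
  rw [Fintype.prod_sum]
  refine Finset.sum_congr rfl fun c _ => ?_
  rw [Fintype.prod_sum]
  -- Guesses made separately at each vertex form one function on all half-edges, because the fibres
  -- of `f` partition `H`.
  let e : (H → ZMod 2) ≃ ((i : V) → {h // f h = i} → ZMod 2) :=
    ((Equiv.sigmaFiberEquiv f).arrowCongr (Equiv.refl _)).symm.trans
      (Equiv.piCurry fun _ _ => ZMod 2)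
  rw [← e.sum_comp]
  refine Finset.sum_congr rfl fun ε _ => ?_
  have he : ∀ i (h : {h // f h = i}), e ε i h = ε h := fun _ _ => rfl
  simp only [he]
  rw [Finset.prod_mul_distrib, map_prod]
  congr 1
  · refine Finset.prod_congr rfl fun i _ => ?_
    congr 2
    rw [← Fintype.card_subtype, ← Fintype.card_subtype]
    exact Fintype.card_congr 
      (Equiv.subtypeSubtypeEquivSubtypeInter (fun h => f h = i) fun h => ε h = 1)
  · rw [← Fintype.prod_fiberwise f fun h => (MvPolynomial.X (label (c (f h)) (ε h)) :
      MvPolynomial PVar Coeff)]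
    refine Finset.prod_congr rfl fun i _ => Finset.prod_congr rfl fun h _ => ?_
    rw [h.2]

/-- The contractions of colored half-edges are the multigraphs that induce their colors. -/
def contractionEquivMultigraph (f : H → V) (c : V → ZMod 2) (ε : H → ZMod 2) :
    Contraction (fun h => label (c (f h)) (ε h)) ≃
      {G : Multigraph V H // G.vert = f ∧ (fun h => c (G.vert (G.flip h))) = ε} where
  toFun g := ⟨⟨f, g.1, g.2.1, g.2.2.1⟩, rfl, funext fun h => by
    have := g.2.2.2 h
    rw [partner_label, label_inj] at this
    exact this.1⟩
  invFun G := ⟨G.1.flip, G.1.flip_flip, G.1.flip_ne, fun h => by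
    obtain ⟨G, rfl, rfl⟩ := G
    rw [partner_label, label_inj]
    exact ⟨rfl, by simp only [G.flip_flip]⟩⟩
  left_inv g := rfl
  right_inv G := by
    obtain ⟨G, rfl, rfl⟩ := G
    rfl

/-- For fixed `c`, a contraction is a multigraph whose true opposite colors are `ε`. Each multigraph
induces just one `ε`, so summing over `ε` counts each of them once, and the guessed numbers of black
ends become its black degrees. -/
theorem expect_prod_flower (f : H → V) :
    expect Coeff (∏ i, flower (Finset.univ.filter fun h => f h = i).card) =
      ∑ G : Multigraph V H with G.vert = f, Polynomial.aeval t G.bwPoly := by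
  classical
  rw [prod_flower]
  simp only [map_sum, ← MvPolynomial.smul_eq_C_mul, map_smul, expect_prod_X, smul_eq_mul,
    Multigraph.aeval_bwPoly]
  rw [Finset.sum_comm]
  rw [Finset.sum_comm]
  rw [Finset.sum_comm (s := Finset.univ.filter fun G : Multigraph V H => G.vert = f)]
  refine Finset.sum_congr rfl fun c _ => ?_
  rw [← Finset.sum_fiberwise (Finset.univ.filter fun G : Multigraph V H => G.vert = f)
    fun G h => c (G.vert (G.flip h))]
  refine Finset.sum_congr rfl fun ε _ => ?_
  rw [Nat.card_congr (contractionEquivMultigraph f c ε), Nat.card_eq_fintype_card,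
    Fintype.card_subtype, Finset.filter_filter, mul_comm, ← nsmul_eq_mul, ← Finset.sum_const]
  refine Finset.sum_congr rfl fun G hG => ?_
  obtain ⟨rfl, rfl⟩ := (Finset.mem_filter.1 hG).2
  rfl

theorem sum_expect_prod_flower :
    ∑ f : H → V, expect Coeff (∏ i, (flower (Finset.univ.filter fun h => f h = i).card *
      MvPolynomial.C (degVar (Finset.univ.filter fun h => f h = i).card))) =
      Multigraph.totalWeight V H := by
  rw [Multigraph.totalWeight, ← Finset.sum_fiberwise _ Multigraph.vert]
  refine Finset.sum_congr rfl fun f _ => ?_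
  rw [Finset.prod_mul_distrib, ← map_prod, mul_comm, ← MvPolynomial.smul_eq_C_mul, map_smul,
    expect_prod_flower, smul_eq_mul, Finset.mul_sum]
  refine Finset.sum_congr rfl fun G hG => ?_
  rw [mul_comm, Multigraph.weight, ← (Finset.mem_filter.1 hG).2]
  rfl

end

/-! ### The expectation of the exponential -/

theorem S_eq : S = PowerSeries.mk fun k =>
    ((k.factorial : ℚ)⁻¹) • (flower k * MvPolynomial.C (degVar k)) := by
  ext1 k
  rw [S, PowerSeries.coeff_mk, PowerSeries.coeff_mk]
  by_cases hk : 0 < k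
  · rw [dif_pos hk, degVar_of_pos hk]
  · rw [dif_neg hk, Nat.eq_zero_of_not_pos hk, degVar_zero, map_zero, mul_zero, smul_zero]

theorem expect_rat_smul (r : ℚ) (x : MvPolynomial PVar Coeff) :
    expect Coeff (r • x) = r • expect Coeff x := by
  rw [← algebraMap_smul Coeff r x, map_smul, algebraMap_smul]

theorem coeff_expS (d : ℕ) : PowerSeries.coeff d expS =
    ∑ v ∈ Finset.range (d + 1), ((v.factorial : ℚ)⁻¹) • PowerSeries.coeff d (S ^ v) := by
  rw [expS, coeff_exp_subst_mvPolynomial constantCoeff_S]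

theorem coeff_S_pow (v d : ℕ) : PowerSeries.coeff d (S ^ v) =
    ((d.factorial : ℚ)⁻¹) • ∑ f : Fin d → Fin v, ∏ i,
      (flower (Finset.univ.filter fun h => f h = i).card *
        MvPolynomial.C (degVar (Finset.univ.filter fun h => f h = i).card)) := by
  rw [S_eq]
  exact coeff_mk_factorial_pow (fun k => flower k * MvPolynomial.C (degVar k)) v d

/-- The `1 / v!` of the exponential and the `1 / d!` of the flower series are the normalization of
labelled multigraphs. -/
theorem expectSeries_expS : expectSeries expS = totalSeries := by
  ext1 d
  rw [expectSeries, PowerSeries.coeff_mk, coeff_expS, totalSeries, PowerSeries.coeff_mk, map_sum]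
  refine Finset.sum_congr rfl fun v _ => ?_
  rw [coeff_S_pow, expect_rat_smul, expect_rat_smul, map_sum, smul_smul, mul_inv,
    sum_expect_prod_flower]

end BW

end

theorem theorem3p2 :
    -- the sums over graphs that define the coefficients of the two graph series are finite
    (∀ d : ℕ, {n : ℕ+ →₀ ℕ | BW.profileSize n = d}.Finite) ∧
    (∀ n : ℕ+ →₀ ℕ, (BW.graphs n).Finite) ∧
    -- the expectation is the series of all graphs
    BW.expectSeries BW.expS = BW.graphSeries BW.graphs ∧
    -- the series of the connected graphs is its logarithm (of a series with constant term `1`)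
    PowerSeries.constantCoeff (BW.expectSeries BW.expS) = 1 ∧
    BW.connectedSeries = PowerSeries.logOf (BW.expectSeries BW.expS) := by
  refine ⟨BW.finite_profileSize_eq, BW.finite_graphs, ?_, ?_, ?_⟩
  · rw [BW.expectSeries_expS, BW.graphSeries_graphs]
  · rw [BW.expectSeries_expS, BW.constantCoeff_totalSeries]
  · rw [BW.expectSeries_expS, BW.connectedSeries_eq_logOf]
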